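/- **Setting.** Let $n,L\ge 1$ with $nL\ge 2$. Let $T\in\mathbb R^{n\times n\times n}$ be a real array (in the application, the symmetric third-order cumulant tensor) and let $g=(g_1,\dots,g_L)$, $h=(h_1,\dots,h_L)$ be lists of real filters of length $n$. Let $F=(\omega^{(m-1)(k-1)})_{m,k}$ with $\omega=e^{-2\pi i/n}$, $\mathsf{FFT}(f)=Ff$, $U=\sqrt n\,F^{-1}$, $\mathbf U=\mathrm{blkdiag}(U,\dots,U)\in\mathbb C^{nL\times nL}$ and $\mathbf I=[I,\dots,I]\in\mathbb R^{n\times nL}$. For $m\in[n]$ let $\Gamma^{(m)}=(T_{m,i,j})_{i,j}$ and $\Phi^{(m)}=\mathbf U^{\mathsf H}\mathbf I^\top\Gamma^{(m)}\mathbf I\,\mathbf U$. These matrices do not depend on the filters. **One mode update.** Let $v=[\mathsf{FFT}(g_1);\dots;\mathsf{FFT}(g_L)]$ and $z=[\mathsf{FFT}(h_1);\dots;\mathsf{FFT}(h_L)]$, and let $\Psi=\Psi(g,h)\in\mathbb C^{nL\times nL}$ be the matrix whose $(j,l)$ block of size $n\times n$ is the diagonal matrix $$\mathsf{diag}^{\mathsf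 H}(\mathsf{FFT}(g_j))\,\mathsf{diag}^{\mathsf H}(\mathsf{FFT}(h_j))\,\mathsf{diag}(\mathsf{FFT}(g_l))\,\mathsf{diag}(\mathsf{FFT}(h_l)).$$ Let $M=M(g,h)$ be the real $n\times nL$ matrix with rows $$M^m=\sum_{j\in[nL]}\mathbf U^j\,\mathsf{diag}^{\mathsf H}(z)\,\Phi^{(m)}\,\mathsf{diag}(v)\,(\mathbf U^j)^{\mathsf H}\;\mathbf U^j\,\Psi^\dagger\,\mathbf U^{\mathsf H},\qquad m\in[n],$$ where $\mathbf U^j$ is the $j$-th row of $\mathbf U$ and $\dagger$ is the Moore–Penrose inverse. Write $\mathsf{blk}_l(M)$ for the $l$-th $n\times n$ block of $M$, and $\mathsf{blk}_l(M)^i_j$, $\mathsf{blk}_l(M)_j$ for its $(i,j)$ entry and its $j$-th column. The updated filters and weights are $$f_l(p)=\frac{\sum_{i,j\in[n]}\|\mathsf{blk}_l(M)_j\|^{-1}\,\mathsf{blk}_l(M)^i_j\,\mathbf 1[(i-j)\bmod n=p-1]}{\sum_{i,j\in[n]}\mathbf 1[(i-j)\bmod n=p-1]}\quad(l\in[L],\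 p\in[n]),\qquad \lambda(b)=\|M_b\|\quad(b\in[nL]),$$ with Euclidean norms, a zero column contributing $0$ to the sum. Denote the filters by $\mathcal A(g,h)$. **One iteration** of the convolutional tensor ALS algorithm updates the three modes in turn: $f'=\mathcal A(g,h)$, $g'=\mathcal A(h,f')$, $h'=\mathcal A(f',g')$, together with the weights computed in each of the three updates. **Machine.** A synchronous parallel random access machine over the reals with $P$ processors executes one fixed program. In one time unit all processors execute the same instruction: processor $i$ reads at most two shared memory cells (concurrent reads are allowed), performs one operation (copying, conversion of an integer to a real, $+,-,\times,/$ with $x/0=0$, or $\sqrt{\cdot}$), and writes the result to a cell that only it can write; addresses and guards are integer expressions in the processor number and in the variables of the control unit. Each assignment and each loop test on the integer variables of the control unit also takes one time unit. At the start the control unit holds $n,L,P$, and the memory holds $g$, $h$, the matrices $\Phi^{(m)}$ (which are the same for all iterations and are computed only once) and the $n$-th roots of unity. **Lemma (Computational Complexity).** One iteration can be carried out in $O(\log n+\log L)$ time using $O(L^2n^3)$ processors: there are a single program and a constant $c$ such that for all $n,L\ge1$ with $nL\ge2$ and all $T,g,h$ the program, run on $P=cL^2n^3$ processors, halts after at most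 $c(\log n+\log L)$ time units with the exact values of $f',g',h'$ and of the weights of the three updates in its memory. -/

import Mathlib

open scoped Kronecker

/-! ### Discrete Fourier transform and the Moore-Penrose inverse -/

namespace ConvTensor

noncomputable section

/-- The `n × n` discrete Fourier transform matrix, with (zero-based) entries
`ω ^ (m k)`, `ω = exp (-2πi / n)`. -/
def dftMatrix (n : ℕ) : Matrix (Fin n) (Fin n) ℂ :=
  Matrix.of fun m k =>
    Complex.exp (-(2 * (Real.pi : ℂ) * Complex.I) / (n : ℂ)) ^ ((m : ℕ) * (k : ℕ))

/-- The discrete Fourier transform of a real filter of length `n`. -/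
def fft {n : ℕ} (f : Fin n → ℝ) : Fin n → ℂ :=
  (dftMatrix n).mulVec fun p => (f p : ℂ)

/-- `U = √n F⁻¹`, the matrix of eigenvectors of all `n × n` circulant matrices. -/
def eigMatrix (n : ℕ) : Matrix (Fin n) (Fin n) ℂ :=
  ((Real.sqrt n : ℝ) : ℂ) • (dftMatrix n)⁻¹

/-- The four Penrose equations: `X` is a Moore-Penrose inverse of `A`. -/
structure IsMoorePenrose {ι κ : Type*} [Fintype ι] [Fintype κ]
    (A : Matrix ι κ ℂ) (X : Matrix κ ι ℂ) : Prop where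
  mul_mul_left : A * X * A = A
  mul_mul_right : X * A * X = X
  isHermitian_left : (A * X).IsHermitian
  isHermitian_right : (X * A).IsHermitian

theorem IsMoorePenrose.unique {ι κ : Type*} [Fintype ι] [Fintype κ]
    {A : Matrix ι κ ℂ} {X Y : Matrix κ ι ℂ}
    (hX : IsMoorePenrose A X) (hY : IsMoorePenrose A Y) : X = Y := by
  have e1 : A * X = A * Y := by
    calc A * X = (A * X).conjTranspose := hX.isHermitian_left.symm
      _ = ((A * Y) * (A * X)).conjTranspose := by
          rw [← Matrix.mul_assoc (A * Y) A X, hY.mul_mul_left]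
      _ = (A * X) * (A * Y) := by
          rw [Matrix.conjTranspose_mul, hX.isHermitian_left.eq, hY.isHermitian_left.eq]
      _ = A * Y := by rw [← Matrix.mul_assoc (A * X) A Y, hX.mul_mul_left]
  have e2 : X * A = Y * A := by
    calc X * A = (X * A).conjTranspose := hX.isHermitian_right.symm
      _ = ((X * A) * (Y * A)).conjTranspose := by
          rw [Matrix.mul_assoc X A (Y * A), ← Matrix.mul_assoc A Y A, hY.mul_mul_left]
      _ = (Y * A) * (X * A) := by
          rw [Matrix.conjTranspose_mul, hX.isHermitian_right.eq, hY.isHermitian_right.eq]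
      _ = Y * A := by
          rw [Matrix.mul_assoc Y A (X * A), ← Matrix.mul_assoc A X A, hX.mul_mul_left]
  calc X = X * A * X := hX.mul_mul_right.symm
    _ = Y * A * Y := by rw [e2, Matrix.mul_assoc, e1, ← Matrix.mul_assoc]
    _ = Y := hY.mul_mul_right

open scoped ComplexOrder in
theorem exists_isMoorePenrose {ι κ : Type*} [Fintype ι] [Fintype κ]
    (A : Matrix ι κ ℂ) : ∃ X, IsMoorePenrose A X := by
  classical
  have hH : (A.conjTranspose * A).IsHermitian := Matrix.isHermitian_conjTranspose_mul_self A
  set W : Matrix κ κ ℂ := (hH.eigenvectorUnitary : Matrix κ κ ℂ) with hW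
  set d : κ → ℂ := fun i => ((hH.eigenvalues i : ℝ) : ℂ) with hd
  have hWW : W.conjTranspose * W = 1 := Unitary.coe_star_mul_self hH.eigenvectorUnitary
  have hs : A.conjTranspose * A = W * Matrix.diagonal d * W.conjTranspose := hH.spectral_theorem
  set X0 : Matrix κ κ ℂ := W * Matrix.diagonal (fun i => (d i)⁻¹) * W.conjTranspose with hX0
  have key : ∀ a b : κ → ℂ, (W * Matrix.diagonal a * W.conjTranspose) *
      (W * Matrix.diagonal b * W.conjTranspose)
        = W * Matrix.diagonal (fun i => a i * b i) * W.conjTranspose := by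
    intro a b
    calc _ = W * Matrix.diagonal a * (W.conjTranspose * W) * Matrix.diagonal b
          * W.conjTranspose := by simp only [Matrix.mul_assoc]
      _ = _ := by
          rw [hWW, Matrix.mul_one, Matrix.mul_assoc W, Matrix.diagonal_mul_diagonal]
  have herm : ∀ a : κ → ℂ, (∀ i, star (a i) = a i) →
      (W * Matrix.diagonal a * W.conjTranspose).IsHermitian := by
    intro a ha
    have : star a = a := funext ha
    simp [Matrix.IsHermitian, Matrix.conjTranspose_mul, Matrix.diagonal_conjTranspose, this,
      Matrix.mul_assoc]
  have hds : ∀ i, star (d i) = d i := fun i => Complex.conj_ofReal _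
  have hX0H : X0.IsHermitian := herm _ fun i => by rw [star_inv₀, hds]
  have h1 : X0 * (A.conjTranspose * A) * X0 = X0 := by
    rw [hs, hX0, key, key]
    congr 3
    funext i
    by_cases h : d i = 0 <;> simp [h]
  have h2 : (A.conjTranspose * A) * (X0 * (A.conjTranspose * A)) = A.conjTranspose * A := by
    rw [hs, hX0, key, key]
    congr 3
    funext i
    by_cases h : d i = 0 <;> simp [h]
  have h3 : A * (X0 * (A.conjTranspose * A)) = A := by
    have : A.conjTranspose * A * (X0 * (A.conjTranspose * A) - 1) = 0 := by
      rw [Matrix.mul_sub, h2, Matrix.mul_one, sub_self]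
    have := (Matrix.conjTranspose_mul_self_mul_eq_zero A _).1 this
    rwa [Matrix.mul_sub, Matrix.mul_one, sub_eq_zero] at this
  refine ⟨X0 * A.conjTranspose, ?_, ?_, ?_, ?_⟩
  · simpa only [Matrix.mul_assoc] using h3
  · have := congrArg (· * A.conjTranspose) h1
    simpa only [Matrix.mul_assoc] using this
  · simp only [Matrix.IsHermitian, Matrix.conjTranspose_mul, Matrix.conjTranspose_conjTranspose,
      hX0H.eq, Matrix.mul_assoc]
  · rw [Matrix.mul_assoc, hs, hX0, key]
    exact herm _ fun i => by rw [star_mul', star_inv₀, hds]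

/-- The Moore-Penrose inverse of a complex matrix. -/
def pinv {ι κ : Type*} [Fintype ι] [Fintype κ] (A : Matrix ι κ ℂ) : Matrix κ ι ℂ :=
  Classical.choose (exists_isMoorePenrose A)

theorem pinv_spec {ι κ : Type*} [Fintype ι] [Fintype κ] (A : Matrix ι κ ℂ) :
    IsMoorePenrose A (pinv A) :=
  Classical.choose_spec (exists_isMoorePenrose A)

/-! ### The iteration

Vectors of length `n L` are row-stacked, and are indexed by `Fin L × Fin n` (block, position). -/

/-- The column-stacked identity `[I, …, I]`, of size `n × n L`. -/
def stackedId (n L : ℕ) : Matrix (Fin n) (Fin L × Fin n) ℂ :=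
  Matrix.of fun i a => if i = a.2 then 1 else 0

/-- The block diagonal matrix `blkdiag (U, …, U)`, of size `n L × n L`. -/
def blockEig (n L : ℕ) : Matrix (Fin L × Fin n) (Fin L × Fin n) ℂ :=
  (1 : Matrix (Fin L) (Fin L) ℂ) ⊗ₖ eigMatrix n

/-- The stacked vector `[FFT (g₁); …; FFT (g_L)]`. -/
def stackedFft {n L : ℕ} (g : Fin L → Fin n → ℝ) : Fin L × Fin n → ℂ :=
  fun a => fft (g a.1) a.2

/-- The `(j, l)` block of `Ψ`, a diagonal `n × n` matrix. -/
def psiBlock {n L : ℕ} (g h : Fin L → Fin n → ℝ) (j l : Fin L) : Matrix (Fin n) (Fin n) ℂ :=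
  (Matrix.diagonal (fft (g j))).conjTranspose * (Matrix.diagonal (fft (h j))).conjTranspose *
    Matrix.diagonal (fft (g l)) * Matrix.diagonal (fft (h l))

/-- The matrix `Ψ` with `L × L` diagonal blocks of size `n × n`. -/
def psi {n L : ℕ} (g h : Fin L → Fin n → ℝ) : Matrix (Fin L × Fin n) (Fin L × Fin n) ℂ :=
  Matrix.of fun a b => psiBlock g h a.1 b.1 a.2 b.2

/-- `Γ⁽ᵐ⁾`: the `m`-th row of the unfolding `[T_{::1}, …, T_{::n}]` of the tensor `T`, as an
`n × n` matrix whose `(i, j)` entry is the entry of that row in column `i` of the `j`-th slice. -/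
def gammaMatrix {n : ℕ} (T : Fin n → Fin n → Fin n → ℝ) (m : Fin n) :
    Matrix (Fin n) (Fin n) ℂ :=
  Matrix.of fun i j => (T m i j : ℂ)

/-- `Φ⁽ᵐ⁾ = 𝐔ᴴ 𝐈ᵀ Γ⁽ᵐ⁾ 𝐈 𝐔`; it depends on the tensor only, not on the filters. -/
def phiMatrix {n : ℕ} (L : ℕ) (T : Fin n → Fin n → Fin n → ℝ) (m : Fin n) :
    Matrix (Fin L × Fin n) (Fin L × Fin n) ℂ :=
  (blockEig n L).conjTranspose * (stackedId n L).transpose * gammaMatrix T m *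
    stackedId n L * blockEig n L

/-- The `n × n L` matrix `M`, whose `m`-th row is
`∑ j, 𝐔ʲ diagᴴ(z) Φ⁽ᵐ⁾ diag(v) (𝐔ʲ)ᴴ 𝐔ʲ Ψ† 𝐔ᴴ`, where `v` and `z` are the stacked Fourier
coefficients of the filters `g` and `h` of the two fixed modes. -/
def newCumC {n L : ℕ} (T : Fin n → Fin n → Fin n → ℝ) (g h : Fin L → Fin n → ℝ) :
    Matrix (Fin n) (Fin L × Fin n) ℂ :=
  Matrix.of fun m b => ∑ j : Fin L × Fin n,
    (blockEig n L * (Matrix.diagonal (stackedFft h)).conjTranspose * phiMatrix L T m *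
        Matrix.diagonal (stackedFft g) * (blockEig n L).conjTranspose) j j *
      (blockEig n L * pinv (psi g h) * (blockEig n L).conjTranspose) j b

/-- `M` as a real matrix. Its entries are real numbers (all filters and `T` are real), so that
taking real parts here only changes the type. -/
def newCum {n L : ℕ} (T : Fin n → Fin n → Fin n → ℝ) (g h : Fin L → Fin n → ℝ) :
    Matrix (Fin n) (Fin L × Fin n) ℝ :=
  (newCumC T g h).map Complex.re

/-- Euclidean norm of the `b`-th column of a matrix. -/
def colNorm {ι κ : Type*} [Fintype ι] (M : Matrix ι κ ℝ) (b : κ) : ℝ :=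
  Real.sqrt (∑ i, M i b ^ 2)

/-- The closed form filter update. Subtraction in `Fin n` is modulo `n`, so `i - j = p` says
`(i - j) mod n = p` (with zero-based indices). A zero column contributes `0`. -/
def filterUpdate {n L : ℕ} (M : Matrix (Fin n) (Fin L × Fin n) ℝ) (l : Fin L) (p : Fin n) : ℝ :=
  (∑ i : Fin n, ∑ j : Fin n, (colNorm M (l, j))⁻¹ * M i (l, j) * (if i - j = p then 1 else 0)) /
    ∑ i : Fin n, ∑ j : Fin n, (if i - j = p then 1 else 0)

/-- The updated filters of a mode, from the filters `g`, `h` of the other two modes. -/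
def modeFilters {n L : ℕ} (T : Fin n → Fin n → Fin n → ℝ) (g h : Fin L → Fin n → ℝ) :
    Fin L → Fin n → ℝ :=
  filterUpdate (newCum T g h)

/-- The updated weights `λ` (one for each column of `M`), from the filters of the two fixed
modes. -/
def modeWeights {n L : ℕ} (T : Fin n → Fin n → Fin n → ℝ) (g h : Fin L → Fin n → ℝ) :
    Fin L → Fin n → ℝ :=
  fun l p => colNorm (newCum T g h) (l, p)

/-- The result of one iteration: new filters of the three modes, and the weights computed in each
of the three mode updates (those of the last one are the current `Λ`). -/
structure SweepResult (n L : ℕ) where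
  f : Fin L → Fin n → ℝ
  g : Fin L → Fin n → ℝ
  h : Fin L → Fin n → ℝ
  weightsF : Fin L → Fin n → ℝ
  weightsG : Fin L → Fin n → ℝ
  weightsH : Fin L → Fin n → ℝ

/-- One iteration of the alternating method: the three modes are updated one after the other,
each with the other two fixed. The (symmetric) tensor `T` has the same unfolding for each mode. -/
def sweep {n L : ℕ} (T : Fin n → Fin n → Fin n → ℝ) (g h : Fin L → Fin n → ℝ) :
    SweepResult n L :=
  let f' := modeFilters T g h
  let g' := modeFilters T h f'
  let h' := modeFilters T f' g'
  { f := f', g := g', h := h',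
    weightsF := modeWeights T g h,
    weightsG := modeWeights T h f',
    weightsH := modeWeights T f' g' }

end

end ConvTensor

/-! ### A synchronous parallel random access machine over the reals

There are `P` processors `0, …, P - 1` and a shared memory of real cells `mem a i`, where the
numeral `a` names an array and `i` is a position. In one parallel step all processors execute the
same instruction synchronously: processor `i` reads at most two cells anywhere in the memory
(concurrent reads are allowed), performs one real operation, and writes the result to its own
cell `mem a i` of one array, so that there are no write conflicts. Addresses and guards are
integer expressions in the processor number and in the integer variables of the control unit.
A program is a fixed finite text: it does not depend on the size of the input or on `P`. -/

namespace Pram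

noncomputable section

/-- Integer expressions; `self` is the number of the processor, `var x` a variable of the control
unit. -/
inductive IExpr : Type
  | const (k : ℕ)
  | self
  | var (x : ℕ)
  | add (e₁ e₂ : IExpr)
  | sub (e₁ e₂ : IExpr)
  | mul (e₁ e₂ : IExpr)
  | div (e₁ e₂ : IExpr)
  | mod (e₁ e₂ : IExpr)

/-- Value of an integer expression at processor `i` (truncated subtraction, rounded division). -/
def IExpr.eval (i : ℕ) (vars : ℕ → ℕ) : IExpr → ℕ
  | .const k => k
  | .self => i
  | .var x => vars x
  | .add e₁ e₂ => e₁.eval i vars + e₂.eval i vars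
  | .sub e₁ e₂ => e₁.eval i vars - e₂.eval i vars
  | .mul e₁ e₂ => e₁.eval i vars * e₂.eval i vars
  | .div e₁ e₂ => e₁.eval i vars / e₂.eval i vars
  | .mod e₁ e₂ => e₁.eval i vars % e₂.eval i vars

/-- A memory operand: the array named `arr` at the position given by `idx`. -/
structure Operand where
  arr : ℕ
  idx : IExpr

/-- Value of an operand at processor `i`. -/
def Operand.eval (i : ℕ) (vars : ℕ → ℕ) (mem : ℕ → ℕ → ℝ) (o : Operand) : ℝ :=
  mem o.arr (o.idx.eval i vars)

/-- The real operations; each of them takes one time unit. -/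
inductive Op : Type
  | ofInt (e : IExpr)
  | copy (x : Operand)
  | add (x y : Operand)
  | sub (x y : Operand)
  | mul (x y : Operand)
  | div (x y : Operand)
  | sqrt (x : Operand)

/-- Value of an operation at processor `i`. Division by zero gives zero. -/
def Op.eval (i : ℕ) (vars : ℕ → ℕ) (mem : ℕ → ℕ → ℝ) : Op → ℝ
  | .ofInt e => (e.eval i vars : ℝ)
  | .copy x => x.eval i vars mem
  | .add x y => x.eval i vars mem + y.eval i vars mem
  | .sub x y => x.eval i vars mem - y.eval i vars mem
  | .mul x y => x.eval i vars mem * y.eval i vars mem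
  | .div x y => x.eval i vars mem / y.eval i vars mem
  | .sqrt x => Real.sqrt (x.eval i vars mem)

/-- Programs: a parallel step (each processor at which `guard` is not zero writes the value of
`op` to its cell of the array `arr`), an assignment to a variable of the control unit, sequential
composition, and a loop that runs while an integer expression is not zero. -/
inductive Prog : Type
  | par (guard : IExpr) (arr : ℕ) (op : Op)
  | set (x : ℕ) (e : IExpr)
  | seq (p q : Prog)
  | loop (e : IExpr) (p : Prog)

/-- A configuration: the integer variables of the control unit and the real memory. -/
structure State where
  vars : ℕ → ℕ
  mem : ℕ → ℕ → ℝ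

open Classical in
/-- The effect of one parallel step on `P` processors. -/
def State.parStep (P : ℕ) (guard : IExpr) (arr : ℕ) (op : Op) (s : State) : State where
  vars := s.vars
  mem := fun a i =>
    if a = arr ∧ i < P ∧ guard.eval i s.vars ≠ 0 then op.eval i s.vars s.mem else s.mem a i

/-- The effect of an assignment of the control unit (which has no processor number; `self` is
read as `0`). -/
def State.assign (x : ℕ) (e : IExpr) (s : State) : State where
  vars := Function.update s.vars x (e.eval 0 s.vars)
  mem := s.mem

/-- `Exec P p s s' t`: with `P` processors the program `p`, started in the configuration `s`, halts
in the configuration `s'` after `t` time units. Each parallel step, each assignment and each test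
of a loop condition takes one time unit. -/
inductive Exec (P : ℕ) : Prog → State → State → ℕ → Prop
  | par (guard : IExpr) (arr : ℕ) (op : Op) (s : State) :
      Exec P (.par guard arr op) s (s.parStep P guard arr op) 1
  | set (x : ℕ) (e : IExpr) (s : State) :
      Exec P (.set x e) s (s.assign x e) 1
  | seq {p q : Prog} {s₁ s₂ s₃ : State} {t u : ℕ} :
      Exec P p s₁ s₂ t → Exec P q s₂ s₃ u → Exec P (.seq p q) s₁ s₃ (t + u)
  | loop_stop {e : IExpr} {p : Prog} {s : State} :
      e.eval 0 s.vars = 0 → Exec P (.loop e p) s s 1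
  | loop_step {e : IExpr} {p : Prog} {s₁ s₂ s₃ : State} {t u : ℕ} :
      e.eval 0 s₁.vars ≠ 0 → Exec P p s₁ s₂ t → Exec P (.loop e p) s₂ s₃ u →
      Exec P (.loop e p) s₁ s₃ (1 + t + u)

end

end Pram

namespace ConvTensor

noncomputable section

/-- The array named `a` holds the filters (or weights) `x`, one after the other. -/
def HoldsFilters {n L : ℕ} (s : Pram.State) (a : ℕ) (x : Fin L → Fin n → ℝ) : Prop :=
  ∀ (l : Fin L) (p : Fin n), s.mem a ((l : ℕ) * n + p) = x l p

/-- Position of the `(a, b)` entry of `Φ⁽ᵐ⁾` in memory: the matrices are stored one after the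
other, each row by row. -/
def phiAddress {n L : ℕ} (m : Fin n) (a b : Fin L × Fin n) : ℕ :=
  ((m : ℕ) * (L * n) + ((a.1 : ℕ) * n + a.2)) * (L * n) + ((b.1 : ℕ) * n + b.2)

/-- The configurations in which an iteration starts on `P` processors. The integer variables
`0, 1, 2` hold `n`, `L`, `P`; the arrays `0` and `1` hold the current filters `g` and `h`; the
arrays `2` and `3` hold the real and imaginary parts of all `Φ⁽ᵐ⁾`, which are the same for all
iterations; the arrays `4` and `5` hold the real and imaginary parts of the `n`-th roots of unity
`exp (-2πi k / n)`. Nothing is assumed about the rest. -/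
structure IsInput {n L : ℕ} (P : ℕ) (T : Fin n → Fin n → Fin n → ℝ)
    (g h : Fin L → Fin n → ℝ) (s : Pram.State) : Prop where
  size_n : s.vars 0 = n
  size_L : s.vars 1 = L
  size_P : s.vars 2 = P
  filters_g : HoldsFilters s 0 g
  filters_h : HoldsFilters s 1 h
  phi_re : ∀ (m : Fin n) (a b : Fin L × Fin n),
    s.mem 2 (phiAddress m a b) = (phiMatrix L T m a b).re
  phi_im : ∀ (m : Fin n) (a b : Fin L × Fin n),
    s.mem 3 (phiAddress m a b) = (phiMatrix L T m a b).im
  root_re : ∀ k : Fin n, s.mem 4 k =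
    (Complex.exp (-(2 * (Real.pi : ℂ) * Complex.I) / (n : ℂ)) ^ (k : ℕ)).re
  root_im : ∀ k : Fin n, s.mem 5 k =
    (Complex.exp (-(2 * (Real.pi : ℂ) * Complex.I) / (n : ℂ)) ^ (k : ℕ)).im

/-- The configurations in which the arrays `6` to `11` hold the result of an iteration. -/
structure IsOutput {n L : ℕ} (r : SweepResult n L) (s : Pram.State) : Prop where
  filters_f : HoldsFilters s 6 r.f
  filters_g : HoldsFilters s 7 r.g
  filters_h : HoldsFilters s 8 r.h
  weights_f : HoldsFilters s 9 r.weightsF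
  weights_g : HoldsFilters s 10 r.weightsG
  weights_h : HoldsFilters s 11 r.weightsH

end

end ConvTensor

/-! In the Fourier domain a mode update has a closed form made of short sums. Let w_l(k) be the
product of the k-th Fourier coefficients of g_l and h_l, and let E(k) = ∑_l |w_l(k)|². The matrix Ψ
couples only equal frequencies, and at the frequency k it is the rank-one matrix conj(w(k)) w(k)ᵀ.
Hence Ψ† is the same matrix divided by E(k)², and nothing has to be inverted numerically
(`pinv_psi_apply`). In the row M^m, summing over the rows of 𝐔 within a block is a character sum
that forces the frequencies to satisfy x = y - k (`sum_eigMatrix_mul`). What remains is M^m_(l,q) =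
∑_k w_l(k) c_m(k) ω^(qk) / (n E(k)²), where c_m(k) is a sum of L n terms read off from the diagonal
blocks of Φ⁽ᵐ⁾ (`newCumC_apply`).

Fourier coefficients, energies E(k), the c_m(k), the entries of M, column norms and filters are
therefore families of sums of at most L n terms, and each family has at most L n³ terms in total.
With one processor per term, a term costs a constant number of instructions, and summing by doubling
windows costs O(log(n L)) (`exec_sumProg`). A mode update chains a fixed number of such sums
(`exec_modeProg`), and an iteration is three mode updates. In fact L n³ ≤ L² n³ processors already
do the work. -/

namespace Pram

noncomputable section

/-! ### Straight-line code for real and complex expressions -/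

instance : Add IExpr := ⟨.add⟩
instance : Sub IExpr := ⟨.sub⟩
instance : Mul IExpr := ⟨.mul⟩
instance : Div IExpr := ⟨.div⟩
instance : Mod IExpr := ⟨.mod⟩

section IExprEval

variable (i : ℕ) (vars : ℕ → ℕ) (x y : IExpr)

@[simp] theorem IExpr.eval_const (k : ℕ) : (IExpr.const k).eval i vars = k := rfl
@[simp] theorem IExpr.eval_self : IExpr.self.eval i vars = i := rfl
@[simp] theorem IExpr.eval_var (k : ℕ) : (IExpr.var k).eval i vars = vars k := rfl
@[simp] theorem IExpr.eval_add : (x + y).eval i vars = x.eval i vars + y.eval i vars := rfl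
@[simp] theorem IExpr.eval_sub : (x - y).eval i vars = x.eval i vars - y.eval i vars := rfl
@[simp] theorem IExpr.eval_mul : (x * y).eval i vars = x.eval i vars * y.eval i vars := rfl
@[simp] theorem IExpr.eval_div : (x / y).eval i vars = x.eval i vars / y.eval i vars := rfl
@[simp] theorem IExpr.eval_mod : (x % y).eval i vars = x.eval i vars % y.eval i vars := rfl

end IExprEval

/-- The expression only mentions the input variables `0, 1, 2` of the control unit. -/
def IExpr.Stable : IExpr → Prop
  | .const _ => True
  | .self => True
  | .var x => x < 3
  | .add x y | .sub x y | .mul x y | .div x y | .mod x y => x.Stable ∧ y.Stable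

section IExprStable

variable (x y : IExpr)

@[simp] theorem IExpr.stable_const (k : ℕ) : (IExpr.const k).Stable := trivial
@[simp] theorem IExpr.stable_self : IExpr.self.Stable := trivial
@[simp] theorem IExpr.stable_var (k : ℕ) : (IExpr.var k).Stable ↔ k < 3 := Iff.rfl
@[simp] theorem IExpr.stable_add : (x + y).Stable ↔ x.Stable ∧ y.Stable := Iff.rfl
@[simp] theorem IExpr.stable_sub : (x - y).Stable ↔ x.Stable ∧ y.Stable := Iff.rfl
@[simp] theorem IExpr.stable_mul : (x * y).Stable ↔ x.Stable ∧ y.Stable := Iff.rfl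
@[simp] theorem IExpr.stable_div : (x / y).Stable ↔ x.Stable ∧ y.Stable := Iff.rfl
@[simp] theorem IExpr.stable_mod : (x % y).Stable ↔ x.Stable ∧ y.Stable := Iff.rfl

end IExprStable

/-- Summation loops overwrite the variables 3 and 4, so only expressions confined to the variables
0, 1, 2 keep their value across them. -/
theorem IExpr.Stable.eval_congr {i : ℕ} {vars vars' : ℕ → ℕ} (hv : ∀ x < 3, vars' x = vars x) :
    ∀ {e : IExpr}, e.Stable → e.eval i vars' = e.eval i vars
  | .const _, _ => rfl
  | .self, _ => rfl
  | .var x, h => hv x h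
  | .add _ _, h => congrArg₂ (· + ·) (h.1.eval_congr hv) (h.2.eval_congr hv)
  | .sub _ _, h => congrArg₂ (· - ·) (h.1.eval_congr hv) (h.2.eval_congr hv)
  | .mul _ _, h => congrArg₂ (· * ·) (h.1.eval_congr hv) (h.2.eval_congr hv)
  | .div _ _, h => congrArg₂ (· / ·) (h.1.eval_congr hv) (h.2.eval_congr hv)
  | .mod _ _, h => congrArg₂ (· % ·) (h.1.eval_congr hv) (h.2.eval_congr hv)

/-- Real arithmetic expressions. -/
inductive RExpr : Type
  | ofInt (e : IExpr)
  | cell (a : ℕ) (idx : IExpr)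
  | add (x y : RExpr)
  | sub (x y : RExpr)
  | mul (x y : RExpr)
  | div (x y : RExpr)

namespace RExpr

/-- Value of a real expression at processor `i`. -/
def eval (i : ℕ) (s : State) : RExpr → ℝ
  | ofInt e => (e.eval i s.vars : ℝ)
  | cell a idx => s.mem a (idx.eval i s.vars)
  | add x y => x.eval i s + y.eval i s
  | sub x y => x.eval i s - y.eval i s
  | mul x y => x.eval i s * y.eval i s
  | div x y => x.eval i s / y.eval i s

/-- The expression only mentions arrays below `b` and input variables. -/
def Below (b : ℕ) : RExpr → Prop
  | ofInt e => e.Stable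
  | cell a idx => a < b ∧ idx.Stable
  | add x y | sub x y | mul x y | div x y => x.Below b ∧ y.Below b

/-- Number of instructions of the code of an expression. -/
def time : RExpr → ℕ
  | ofInt _ | cell _ _ => 1
  | add x y | sub x y | mul x y | div x y => x.time + (y.time + 1)

/-- Code that writes the value of the expression to the array `b`, with the arrays above `b` as a
stack of intermediate results. -/
def code (b : ℕ) : RExpr → Prog
  | ofInt e => .par (.const 1) b (.ofInt e)
  | cell a idx => .par (.const 1) b (.copy ⟨a, idx⟩)
  | add x y => (x.code b).seq ((y.code (b + 1)).seq
      (.par (.const 1) b (.add ⟨b, .self⟩ ⟨b + 1, .self⟩)))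
  | sub x y => (x.code b).seq ((y.code (b + 1)).seq
      (.par (.const 1) b (.sub ⟨b, .self⟩ ⟨b + 1, .self⟩)))
  | mul x y => (x.code b).seq ((y.code (b + 1)).seq
      (.par (.const 1) b (.mul ⟨b, .self⟩ ⟨b + 1, .self⟩)))
  | div x y => (x.code b).seq ((y.code (b + 1)).seq
      (.par (.const 1) b (.div ⟨b, .self⟩ ⟨b + 1, .self⟩)))

end RExpr

/-- `s'` agrees with `s` on the input variables and on all arrays below `b`. -/
structure Frame (b : ℕ) (s s' : State) : Prop where
  vars : ∀ x < 3, s'.vars x = s.vars x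
  mem : ∀ a < b, s'.mem a = s.mem a

theorem Frame.trans {b c : ℕ} {s s' s'' : State} (h : Frame b s s') (h' : Frame c s' s'')
    (hbc : b ≤ c) : Frame b s s'' :=
  ⟨fun x hx => (h'.vars x hx).trans (h.vars x hx),
    fun a ha => (h'.mem a (ha.trans_le hbc)).trans (h.mem a ha)⟩

theorem RExpr.Below.mono {b c : ℕ} (hbc : b ≤ c) : ∀ {e : RExpr}, e.Below b → e.Below c
  | .ofInt _, h => h
  | .cell _ _, h => ⟨h.1.trans_le hbc, h.2⟩
  | .add _ _, h | .sub _ _, h | .mul _ _, h | .div _ _, h => ⟨h.1.mono hbc, h.2.mono hbc⟩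

theorem Frame.eval_eq {b i : ℕ} {s s' : State} (hf : Frame b s s') :
    ∀ {e : RExpr}, e.Below b → e.eval i s' = e.eval i s
  | .ofInt e, h => by
      have h : e.Stable := h
      simp only [RExpr.eval, h.eval_congr hf.vars]
  | .cell a idx, h => by
      simp only [RExpr.eval, h.2.eval_congr hf.vars, hf.mem a h.1]
  | .add _ _, h => congrArg₂ (· + ·) (hf.eval_eq h.1) (hf.eval_eq h.2)
  | .sub _ _, h => congrArg₂ (· - ·) (hf.eval_eq h.1) (hf.eval_eq h.2)
  | .mul _ _, h => congrArg₂ (· * ·) (hf.eval_eq h.1) (hf.eval_eq h.2)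
  | .div _ _, h => congrArg₂ (· / ·) (hf.eval_eq h.1) (hf.eval_eq h.2)

theorem State.parStep_mem_self {P b i : ℕ} (op : Op) (s : State) (hi : i < P) :
    (s.parStep P (.const 1) b op).mem b i = op.eval i s.vars s.mem := by
  simp [State.parStep, hi]

theorem State.parStep_mem_ne {P a b : ℕ} (guard : IExpr) (op : Op) (s : State) (h : a ≠ b) :
    (s.parStep P guard b op).mem a = s.mem a := by
  funext i
  simp [State.parStep, h]

theorem State.frame_parStep (P b : ℕ) (guard : IExpr) (op : Op) (s : State) :
    Frame b s (s.parStep P guard b op) :=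
  ⟨fun _ _ => rfl, fun _ ha => State.parStep_mem_ne _ _ _ ha.ne⟩

/-- The four binary operations share this argument: the value of `x` is safe in the array `b` while
`y` is evaluated, because the code of `y` writes only to arrays from `b + 1` on. -/
theorem exec_binary {P b : ℕ} {x y : RExpr} {op : Operand → Operand → Op} {F : ℝ → ℝ → ℝ}
    (hop : ∀ i vars mem u v,
      (op u v).eval i vars mem = F (u.eval i vars mem) (v.eval i vars mem))
    (ihx : ∀ s, x.Below b → ∃ s', Exec P (x.code b) s s' x.time ∧ Frame b s s' ∧
      ∀ i < P, s'.mem b i = x.eval i s)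
    (ihy : ∀ s, y.Below (b + 1) → ∃ s', Exec P (y.code (b + 1)) s s' y.time ∧
      Frame (b + 1) s s' ∧ ∀ i < P, s'.mem (b + 1) i = y.eval i s)
    (s : State) (hx : x.Below b) (hy : y.Below b) :
    ∃ s', Exec P ((x.code b).seq ((y.code (b + 1)).seq
        (.par (.const 1) b (op ⟨b, .self⟩ ⟨b + 1, .self⟩)))) s s' (x.time + (y.time + 1)) ∧
      Frame b s s' ∧ ∀ i < P, s'.mem b i = F (x.eval i s) (y.eval i s) := by
  obtain ⟨s₁, e₁, f₁, v₁⟩ := ihx s hx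
  obtain ⟨s₂, e₂, f₂, v₂⟩ := ihy s₁ (hy.mono b.le_succ)
  refine ⟨_, e₁.seq (e₂.seq (.par _ _ _ _)),
    (f₁.trans f₂ b.le_succ).trans (State.frame_parStep _ _ _ _ _) le_rfl, fun i hi => ?_⟩
  rw [State.parStep_mem_self _ _ hi, hop]
  change F (s₂.mem b i) (s₂.mem (b + 1) i) = _
  rw [f₂.mem b b.lt_succ_self, v₁ i hi, v₂ i hi, f₁.eval_eq hy]

theorem RExpr.exec_code (P : ℕ) : ∀ (e : RExpr) (b : ℕ) (s : State), e.Below b →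
    ∃ s', Exec P (e.code b) s s' e.time ∧ Frame b s s' ∧ ∀ i < P, s'.mem b i = e.eval i s
  | .ofInt _, _, _, _ => ⟨_, .par _ _ _ _, State.frame_parStep _ _ _ _ _,
      fun _ hi => State.parStep_mem_self _ _ hi⟩
  | .cell _ _, _, _, _ => ⟨_, .par _ _ _ _, State.frame_parStep _ _ _ _ _,
      fun _ hi => State.parStep_mem_self _ _ hi⟩
  | .add x y, b, s, h => exec_binary (op := .add) (F := (· + ·)) (fun _ _ _ _ _ => rfl)
      (x.exec_code P b) (y.exec_code P (b + 1)) s h.1 h.2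
  | .sub x y, b, s, h => exec_binary (op := .sub) (F := (· - ·)) (fun _ _ _ _ _ => rfl)
      (x.exec_code P b) (y.exec_code P (b + 1)) s h.1 h.2
  | .mul x y, b, s, h => exec_binary (op := .mul) (F := (· * ·)) (fun _ _ _ _ _ => rfl)
      (x.exec_code P b) (y.exec_code P (b + 1)) s h.1 h.2
  | .div x y, b, s, h => exec_binary (op := .div) (F := (· / ·)) (fun _ _ _ _ _ => rfl)
      (x.exec_code P b) (y.exec_code P (b + 1)) s h.1 h.2

/-! ### Sums over blocks in logarithmic time -/

/-- The loop that sums the blocks of length `var 4` of the array `b`; `var 3` is the length of the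
windows that have been summed. -/
def reduceLoop (b : ℕ) : Prog :=
  .loop (.var 4 - .var 3) <|
    .seq (.par (.var 4 - (.self % .var 4 + .var 3)) b (.add ⟨b, .self⟩ ⟨b, .self + .var 3⟩))
      (.set 3 (.var 3 * .const 2))

/-- A window of length 2d is two adjacent windows of length d, all cut off at the end `B` of the
block. When the second one starts beyond the block it is empty, so the machine may skip the
addition. -/
theorem sum_Ico_window (Y : ℕ → ℝ) (r d B : ℕ) :
    ∑ x ∈ Finset.Ico r (min (r + d * 2) B), Y x =
      ∑ x ∈ Finset.Ico r (min (r + d) B), Y x +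
        if r + d < B then ∑ x ∈ Finset.Ico (r + d) (min (r + d + d) B), Y x else 0 := by
  split_ifs with h
  · rw [min_eq_left h.le, Finset.sum_Ico_consecutive _ (by omega) (by omega)]
    congr 2
    omega
  · rw [add_zero]
    congr 2
    omega

/-- Loop invariant: the cell at offset `r` of each block holds the sum over the window of length `d`
from `r`, cut off at the block end. The window doubles in each round, so `k` rounds suffice, each
costing one test, one parallel step and one assignment; the last test gives the `+ 1`. Blocks not
contained in the first `P` cells are ignored. -/
theorem exec_reduceLoop {P b B : ℕ} (X : ℕ → ℝ) (k : ℕ) : ∀ (d : ℕ) (s : State),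
    s.vars 3 = d → s.vars 4 = B → B ≤ d * 2 ^ k →
    (∀ K r, (K + 1) * B ≤ P → r < B →
      s.mem b (K * B + r) = ∑ x ∈ Finset.Ico r (min (r + d) B), X (K * B + x)) →
    ∃ s' t, Exec P (reduceLoop b) s s' t ∧ t ≤ 3 * k + 1 ∧ Frame b s s' ∧
      ∀ K, 0 < B → (K + 1) * B ≤ P → s'.mem b (K * B) = ∑ x ∈ Finset.range B, X (K * B + x) := by
  have halt : ∀ (d : ℕ) (s : State), s.vars 3 = d → s.vars 4 = B → B ≤ d →
      (∀ K r, (K + 1) * B ≤ P → r < B →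
        s.mem b (K * B + r) = ∑ x ∈ Finset.Ico r (min (r + d) B), X (K * B + x)) →
      ∃ s' t, Exec P (reduceLoop b) s s' t ∧ t ≤ 1 ∧ Frame b s s' ∧
        ∀ K, 0 < B → (K + 1) * B ≤ P →
          s'.mem b (K * B) = ∑ x ∈ Finset.range B, X (K * B + x) := by
    intro d s h3 h4 hB hs
    refine ⟨s, 1, Exec.loop_stop (by simp [h3, h4, hB]), le_rfl,
      ⟨fun _ _ => rfl, fun _ _ => rfl⟩, fun K hB0 hK => ?_⟩
    have := hs K 0 hK hB0
    rwa [zero_add, min_eq_right hB, add_zero, ← Finset.range_eq_Ico] at this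
  induction k with
  | zero =>
    intro d s h3 h4 hB hs
    exact halt d s h3 h4 (by simpa using hB) hs
  | succ k ih =>
    intro d s h3 h4 hB hs
    by_cases hd : B ≤ d
    · obtain ⟨s', t, e, ht, h⟩ := halt d s h3 h4 hd hs
      exact ⟨s', t, e, by omega, h⟩
    -- Subtraction is truncated, so at offset `r` the guard is nonzero exactly when r + d < B. The
    -- step is synchronous: every read sees the sums of the previous round.
    set s₁ := s.parStep P (.var 4 - (.self % .var 4 + .var 3)) b
      (.add ⟨b, .self⟩ ⟨b, .self + .var 3⟩) with hs₁
    set s₂ := s₁.assign 3 (.var 3 * .const 2) with hs₂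
    have f₁ : Frame b s s₁ := State.frame_parStep _ _ _ _ _
    have f₂ : Frame b s s₂ := f₁.trans (c := b)
      ⟨fun x hx => Function.update_of_ne (by omega) _ _, fun _ _ => rfl⟩ le_rfl
    obtain ⟨s', t, e, ht, f', hs'⟩ := ih (d * 2) s₂
      (by simp [hs₂, hs₁, State.assign, State.parStep, h3])
      (by simp [hs₂, hs₁, State.assign, State.parStep, h4])
      (by rw [mul_assoc, ← pow_succ']; exact hB) (by
        intro K r hK hr
        have hmod : (K * B + r) % B = r := by
          rw [mul_comm, Nat.mul_add_mod, Nat.mod_eq_of_lt hr]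
        have hlt : K * B + r < P := by rw [add_mul, one_mul] at hK; omega
        rw [sum_Ico_window]
        change s₁.mem b (K * B + r) = _
        by_cases hrd : r + d < B
        · have : s₁.mem b (K * B + r) = s.mem b (K * B + r) + s.mem b (K * B + r + d) := by
            simp [hs₁, State.parStep, Op.eval, Operand.eval, h3, h4, hmod, hlt]
            omega
          rw [this, if_pos hrd, hs K r hK hr, add_assoc, hs K (r + d) hK hrd]
        · have : s₁.mem b (K * B + r) = s.mem b (K * B + r) := by
            simp [hs₁, State.parStep, Op.eval, Operand.eval, h3, h4, hmod, hlt]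
            omega
          rw [this, if_neg hrd, hs K r hK hr, add_zero])
    exact ⟨s', _, .loop_step (by simp [h3, h4]; omega) (.seq (.par _ _ _ _) (.set _ _ _)) e,
      by omega, f₂.trans f' le_rfl, hs'⟩

/-- With `P` processors, `p` leads from `s` to `s'` in at most `C * ℓ` time units. -/
def Runs (P ℓ C : ℕ) (p : Prog) (s s' : State) : Prop :=
  ∃ t ≤ C * ℓ, Exec P p s s' t

theorem Runs.seq {P ℓ C D : ℕ} {p q : Prog} {s s' s'' : State} (h : Runs P ℓ C p s s')
    (h' : Runs P ℓ D q s' s'') : Runs P ℓ (C + D) (p.seq q) s s'' := by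
  obtain ⟨t, ht, e⟩ := h
  obtain ⟨u, hu, e'⟩ := h'
  exact ⟨_, by rw [add_mul]; omega, e.seq e'⟩

/-- Sum the values of the expression `e` over blocks of length `B` of processors; the sums are left
in the first cells of the blocks of the array `b`. -/
def sumProg (b : ℕ) (e : RExpr) (B : IExpr) : Prog :=
  (e.code b).seq ((Prog.set 4 B).seq ((Prog.set 3 (.const 1)).seq (reduceLoop b)))

/-- The cost of `sumProg`, per unit of the logarithm of the block length. -/
def sumCost (e : RExpr) : ℕ := e.time + 6

theorem exec_sumProg (P ℓ b : ℕ) {e : RExpr} (B : IExpr) {s : State} {N : ℕ} (he : e.Below b)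
    (hB : B.Stable) (hN : B.eval 0 s.vars = N) (hN0 : 0 < N) (hℓ : 0 < ℓ)
    (hNℓ : Nat.clog 2 N ≤ ℓ) :
    ∃ s', Runs P ℓ (sumCost e) (sumProg b e B) s s' ∧ Frame b s s' ∧
      ∀ K, (K + 1) * N ≤ P →
        s'.mem b (K * N) = ∑ x ∈ Finset.range N, e.eval (K * N + x) s := by
  obtain ⟨s₁, e₁, f₁, v₁⟩ := e.exec_code P b s he
  set s₂ := s₁.assign 4 B with hs₂
  set s₃ := s₂.assign 3 (.const 1) with hs₃
  have f₃ : Frame b s₁ s₃ := ⟨fun x hx => (Function.update_of_ne (by omega) _ _).trans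
    (Function.update_of_ne (by omega) _ _), fun _ _ => rfl⟩
  obtain ⟨s', t, e', ht, f', h'⟩ := exec_reduceLoop (P := P) (b := b) (B := N)
    (fun i => e.eval i s) (Nat.clog 2 N) 1 s₃ (by simp [hs₃, State.assign])
    (by simp [hs₃, hs₂, State.assign, hB.eval_congr f₁.vars, hN])
    (by rw [one_mul]; exact Nat.le_pow_clog one_lt_two N) (by
      intro K r hK hr
      have hlt : K * N + r < P := by rw [add_mul, one_mul] at hK; omega
      rw [min_eq_left (by omega), Nat.Ico_succ_singleton, Finset.sum_singleton]
      exact v₁ _ hlt)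
  refine ⟨s', ⟨_, ?_, e₁.seq (.seq (.set _ _ _) (.seq (.set _ _ _) e'))⟩,
    (f₁.trans f₃ le_rfl).trans f' le_rfl, fun K hK => h' K hN0 hK⟩
  -- The total is at most `e.time + 2 + (3 * clog 2 N + 1)`; as `ℓ ≥ 1`, this is at most `(e.time +
  -- 6) * ℓ`.
  rw [sumCost]
  nlinarith [Nat.zero_le e.time]

/-! ### Complex expressions -/

/-- Complex arithmetic expressions, as pairs of real ones. -/
structure CExpr where
  re : RExpr
  im : RExpr

namespace CExpr

/-- Value of a complex expression at processor `i`. -/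
def eval (i : ℕ) (s : State) (x : CExpr) : ℂ := ⟨x.re.eval i s, x.im.eval i s⟩

/-- The complex number with real part in array `a` and imaginary part in array `a + 1`. -/
def cell (a : ℕ) (idx : IExpr) : CExpr := ⟨.cell a idx, .cell (a + 1) idx⟩

/-- Complex conjugation. -/
def conj (x : CExpr) : CExpr := ⟨x.re, .sub (.ofInt (.const 0)) x.im⟩

/-- Complex multiplication. -/
def mul (x y : CExpr) : CExpr :=
  ⟨.sub (.mul x.re y.re) (.mul x.im y.im), .add (.mul x.re y.im) (.mul x.im y.re)⟩

/-- Multiplication of a complex by a real number. -/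
def rmul (x : CExpr) (y : RExpr) : CExpr := ⟨.mul x.re y, .mul x.im y⟩

/-- Both parts only mention arrays below `b`. -/
def Below (b : ℕ) (x : CExpr) : Prop := x.re.Below b ∧ x.im.Below b

variable (i : ℕ) (s : State) (x y : CExpr)

theorem eval_conj : (conj x).eval i s = star (x.eval i s) :=
  Complex.ext rfl (by simp [eval, conj, RExpr.eval])

theorem eval_mul : (mul x y).eval i s = x.eval i s * y.eval i s := rfl

theorem eval_rmul (r : RExpr) : (rmul x r).eval i s = x.eval i s * (r.eval i s : ℝ) := by
  apply Complex.ext <;> simp [eval, rmul, RExpr.eval]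

end CExpr

/-- The complex number with real part in array `a` and imaginary part in array `a + 1`. -/
def State.cmem (s : State) (a i : ℕ) : ℂ := ⟨s.mem a i, s.mem (a + 1) i⟩

theorem CExpr.eval_cell (i : ℕ) (s : State) (a : ℕ) (idx : IExpr) :
    (CExpr.cell a idx).eval i s = s.cmem a (idx.eval i s.vars) := rfl

theorem Frame.cmem {b a : ℕ} {s s' : State} (hf : Frame b s s') (ha : a + 1 < b) (i : ℕ) :
    s'.cmem a i = s.cmem a i := by
  rw [State.cmem, hf.mem a (by omega), hf.mem (a + 1) ha]; rfl

/-- Sum the values of a complex expression over blocks of processors. -/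
def csumProg (b : ℕ) (e : CExpr) (B : IExpr) : Prog :=
  (sumProg b e.re B).seq (sumProg (b + 1) e.im B)

/-- The cost of `csumProg`, per unit of the logarithm of the block length. -/
def csumCost (e : CExpr) : ℕ := sumCost e.re + sumCost e.im

/-- The two sums do not disturb each other: the imaginary part reads only arrays below `b`, which
the first sum leaves alone, and the second sum writes only from `b + 1` on. -/
theorem exec_csumProg (P ℓ b : ℕ) {e : CExpr} (B : IExpr) {s : State} {N : ℕ} (he : e.Below b)
    (hB : B.Stable) (hN : B.eval 0 s.vars = N) (hN0 : 0 < N) (hℓ : 0 < ℓ)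
    (hNℓ : Nat.clog 2 N ≤ ℓ) :
    ∃ s', Runs P ℓ (csumCost e) (csumProg b e B) s s' ∧ Frame b s s' ∧
      ∀ K, (K + 1) * N ≤ P →
        s'.cmem b (K * N) = ∑ x ∈ Finset.range N, e.eval (K * N + x) s := by
  obtain ⟨s₁, r₁, f₁, v₁⟩ := exec_sumProg P ℓ b B he.1 hB hN hN0 hℓ hNℓ
  obtain ⟨s₂, r₂, f₂, v₂⟩ := exec_sumProg P ℓ (b + 1) (s := s₁) B (he.2.mono b.le_succ) hB
    ((hB.eval_congr f₁.vars).trans hN) hN0 hℓ hNℓ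
  refine ⟨s₂, r₁.seq r₂, f₁.trans f₂ b.le_succ, fun K hK => ?_⟩
  apply Complex.ext
  · rw [Complex.re_sum]
    exact (congrFun (f₂.mem b b.lt_succ_self) _).trans (v₁ K hK)
  · rw [Complex.im_sum]
    refine (v₂ K hK).trans (Finset.sum_congr rfl fun x _ => f₁.eval_eq he.2)

end

end Pram

namespace ConvTensor

noncomputable section

/-! ### Closed form of a mode update in the Fourier domain -/

/-- The primitive root of unity `exp (-2πi / n)`. -/
def root (n : ℕ) : ℂ := Complex.exp (-(2 * (Real.pi : ℂ) * Complex.I) / (n : ℂ))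

theorem root_isPrimitiveRoot (n : ℕ) [NeZero n] : IsPrimitiveRoot (root n) n := by
  have := (Complex.isPrimitiveRoot_exp n (NeZero.ne n)).inv
  rwa [← Complex.exp_neg, ← neg_div] at this

theorem star_root (n : ℕ) [NeZero n] : star (root n) = (root n)⁻¹ := by
  have h := (root_isPrimitiveRoot n).norm'_eq_one (NeZero.ne n)
  exact (Complex.inv_eq_conj h).symm

theorem root_pow_mod (n k : ℕ) [NeZero n] : root n ^ (k % n) = root n ^ k :=
  (pow_eq_pow_mod k (root_isPrimitiveRoot n).pow_eq_one).symm

/-- Orthogonality of characters, by the geometric series. The exponent is an integer so that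
differences of indices can be inserted. -/
theorem sum_root_pow (n : ℕ) [NeZero n] (a : ℤ) :
    ∑ p : Fin n, (root n) ^ (a * (p : ℕ)) = if (n : ℤ) ∣ a then (n : ℂ) else 0 := by
  have hr := root_isPrimitiveRoot n
  split_ifs with h
  · obtain ⟨c, rfl⟩ := h
    have : ∀ p : Fin n, root n ^ ((n : ℤ) * c * (p : ℕ)) = 1 := fun p => by
      rw [mul_assoc, zpow_mul, zpow_natCast, hr.pow_eq_one, one_zpow]
    simp [this]
  · have h1 : root n ^ a ≠ 1 := fun h1 => h ((hr.zpow_eq_one_iff_dvd a).1 h1)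
    have : ∀ p : Fin n, root n ^ (a * (p : ℕ)) = (root n ^ a) ^ (p : ℕ) := fun p => by
      rw [zpow_mul, zpow_natCast]
    simp only [this]
    rw [Fin.sum_univ_eq_sum_range (fun p => (root n ^ a) ^ p) n, geom_sum_eq h1, ← zpow_natCast,
      ← zpow_mul, mul_comm, zpow_mul, zpow_natCast, hr.pow_eq_one, one_zpow]
    simp

theorem dftMatrix_apply (n : ℕ) (p k : Fin n) :
    dftMatrix n p k = root n ^ ((p : ℕ) * (k : ℕ)) := rfl

theorem dftMatrix_inv (n : ℕ) [NeZero n] :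
    (dftMatrix n)⁻¹ = (n : ℂ)⁻¹ • (dftMatrix n).conjTranspose := by
  apply Matrix.inv_eq_right_inv
  have hn : (n : ℂ) ≠ 0 := Nat.cast_ne_zero.2 (NeZero.ne n)
  have hr : root n ≠ 0 := Complex.exp_ne_zero _
  ext p q
  rw [Matrix.mul_smul, Matrix.smul_apply, Matrix.mul_apply, Matrix.one_apply]
  have : ∀ k : Fin n, dftMatrix n p k * (dftMatrix n).conjTranspose k q =
      root n ^ (((p : ℕ) - (q : ℕ) : ℤ) * (k : ℕ)) := fun k => by
    rw [Matrix.conjTranspose_apply, dftMatrix_apply, dftMatrix_apply, star_pow, star_root, sub_mul,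
      zpow_sub₀ hr, inv_pow]
    norm_cast
  simp only [this]
  rw [sum_root_pow]
  by_cases h : p = q
  · simp [h, hn]
  · rw [if_neg h, if_neg, smul_zero]
    intro hd
    apply h
    -- Two indices below `n` differ by less than `n`, so divisibility by `n` forces equality.
    have := Int.eq_zero_of_abs_lt_dvd hd (by rw [abs_lt]; constructor <;> omega)
    ext; omega

theorem eigMatrix_apply (n : ℕ) [NeZero n] (p k : Fin n) :
    eigMatrix n p k = ((Real.sqrt n : ℝ) : ℂ)⁻¹ * (root n)⁻¹ ^ ((p : ℕ) * (k : ℕ)) := by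
  have hs : ((Real.sqrt n : ℝ) : ℂ) * ((Real.sqrt n : ℝ) : ℂ) = n := by
    rw [← Complex.ofReal_mul, Real.mul_self_sqrt (Nat.cast_nonneg n)]; simp
  have h0 : ((Real.sqrt n : ℝ) : ℂ) ≠ 0 := fun h => by
    rw [h, mul_zero] at hs; exact NeZero.ne n (by exact_mod_cast hs.symm)
  rw [eigMatrix, dftMatrix_inv, Matrix.smul_apply, Matrix.smul_apply, Matrix.conjTranspose_apply,
    dftMatrix_apply, star_pow, star_root, smul_eq_mul, smul_eq_mul, ← hs, mul_comm (k : ℕ)]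
  field_simp

/-- The Fourier coefficients of the convolutions of `g` and `h`. -/
def prodFft {n L : ℕ} (g h : Fin L → Fin n → ℝ) (l : Fin L) (k : Fin n) : ℂ :=
  fft (g l) k * fft (h l) k

/-- The squared norm of the vector of Fourier coefficients at the frequency `k`. -/
def freqEnergy {n L : ℕ} (g h : Fin L → Fin n → ℝ) (k : Fin n) : ℝ :=
  ∑ l, Complex.normSq (prodFft g h l k)

/-- The frequencies decouple, and at each of them Ψ is the rank-one matrix u uᴴ with u = conj(w). -/
theorem psi_apply {n L : ℕ} (g h : Fin L → Fin n → ℝ) (a b : Fin L × Fin n) :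
    psi g h a b =
      if a.2 = b.2 then star (prodFft g h a.1 a.2) * prodFft g h b.1 a.2 else 0 := by
  simp only [psi, psiBlock, Matrix.of_apply, Matrix.diagonal_conjTranspose,
    Matrix.diagonal_mul_diagonal, Matrix.diagonal_apply, prodFft]
  split_ifs with h
  · simp [mul_assoc]
  · rfl

/-- For a vector u ≠ 0 the Moore-Penrose inverse of u uᴴ is u uᴴ / ‖u‖⁴. For u = 0 both sides
vanish, in agreement with the convention 0⁻¹ = 0. The formula is verified through the Penrose
equations and uniqueness. -/
theorem pinv_psi_apply {n L : ℕ} (g h : Fin L → Fin n → ℝ) (a b : Fin L × Fin n) :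
    pinv (psi g h) a b =
      if a.2 = b.2 then star (prodFft g h a.1 a.2) * prodFft g h b.1 a.2 *
        (((freqEnergy g h a.2 * freqEnergy g h a.2)⁻¹ : ℝ) : ℂ) else 0 := by
  set w := prodFft g h with hw
  -- `c r` puts the weight `r k` on the rank-one block of frequency `k`. Since `c r * c t = c (r * t
  -- * e)`, the Penrose equations become scalar identities at each frequency.
  set c : (Fin n → ℂ) → Matrix (Fin L × Fin n) (Fin L × Fin n) ℂ := fun r =>
    Matrix.of fun a b => if a.2 = b.2 then star (w a.1 a.2) * w b.1 a.2 * r a.2 else 0 with hc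
  set e : Fin n → ℂ := fun k => (freqEnergy g h k : ℂ) with he
  have hpsi : psi g h = c 1 := by
    ext a b; rw [psi_apply]; simp [hc, hw]
  have hmul : ∀ r t, c r * c t = c (r * t * e) := by
    intro r t
    ext a b
    simp only [hc, Matrix.mul_apply, Matrix.of_apply, Fintype.sum_prod_type]
    by_cases hab : a.2 = b.2
    · have : ∀ l, ∑ k, (if a.2 = k then star (w a.1 a.2) * w l a.2 * r a.2 else 0) *
          (if k = b.2 then star (w l k) * w b.1 k * t k else 0) =
          star (w a.1 a.2) * w b.1 a.2 * (r a.2 * t a.2) * (w l a.2 * star (w l a.2)) := by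
        intro l
        rw [Finset.sum_eq_single a.2]
        · rw [if_pos rfl, if_pos hab]; ring
        · intro k _ hk; rw [if_neg hk.symm, zero_mul]
        · simp
      simp only [this]
      rw [if_pos hab, ← Finset.mul_sum]
      have : ∑ l, w l a.2 * star (w l a.2) = e a.2 := by
        simp only [he, freqEnergy, Complex.ofReal_sum]
        exact Finset.sum_congr rfl fun l _ => Complex.mul_conj _
      rw [this]
      simp only [Pi.mul_apply]; ring
    · rw [if_neg hab]
      refine Finset.sum_eq_zero fun l _ => Finset.sum_eq_zero fun k _ => ?_
      by_cases h1 : a.2 = k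
      · rw [if_neg (fun h2 => hab (h1.trans h2)), mul_zero]
      · rw [if_neg h1, zero_mul]
  have hherm : ∀ r : Fin n → ℂ, (∀ k, star (r k) = r k) → (c r).IsHermitian := by
    intro r hr
    ext a b
    simp only [hc, Matrix.conjTranspose_apply, Matrix.of_apply]
    by_cases hab : a.2 = b.2
    · rw [if_pos hab.symm, if_pos hab, star_mul', star_mul', star_star, hr, hab]; ring
    · rw [if_neg (fun h => hab h.symm), if_neg hab, star_zero]
  have hes : ∀ k, star (e k) = e k := fun k => Complex.conj_ofReal _
  set r : Fin n → ℂ := fun k => (e k * e k)⁻¹ with hr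
  have hrs : ∀ k, star (r k) = r k := fun k => by rw [hr]; simp only [star_inv₀, star_mul', hes]
  -- At zero energy the whole block vanishes, so the weights matter only where `e k ≠ 0`, and there
  -- division is legitimate.
  have hzero : ∀ (k : Fin n), e k = 0 → ∀ l, w l k = 0 := by
    intro k hk l
    have h0 : freqEnergy g h k = 0 := Complex.ofReal_eq_zero.1 hk
    have := (Finset.sum_eq_zero_iff_of_nonneg fun l _ => Complex.normSq_nonneg _).1 h0 l
      (Finset.mem_univ l)
    exact Complex.normSq_eq_zero.1 this
  have hcongr : ∀ r t : Fin n → ℂ, (∀ k, e k ≠ 0 → r k = t k) → c r = c t := by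
    intro r t hrt
    ext a b
    simp only [hc, Matrix.of_apply]
    by_cases h0 : e a.2 = 0
    · simp [hzero _ h0]
    · rw [hrt _ h0]
  have hmp : IsMoorePenrose (psi g h) (c r) := by
    rw [hpsi]
    refine ⟨?_, ?_, ?_, ?_⟩
    · rw [hmul, hmul]
      refine hcongr _ _ fun k hk => ?_
      simp only [Pi.mul_apply, Pi.one_apply, hr]; field_simp
    · rw [hmul, hmul]
      refine hcongr _ _ fun k hk => ?_
      simp only [Pi.mul_apply, Pi.one_apply, hr]; field_simp
    · rw [hmul]; exact hherm _ fun k => by simp only [Pi.mul_apply, Pi.one_apply, star_mul',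
        hrs, hes, star_one]
    · rw [hmul]; exact hherm _ fun k => by simp only [Pi.mul_apply, Pi.one_apply, star_mul',
        hrs, hes, star_one]
  rw [(pinv_spec _).unique hmp]
  simp [hc, hr, he]

/-- The contribution of the tensor to the `m`-th row of `M` at the frequency `k`. -/
def freqCum {n L : ℕ} (T : Fin n → Fin n → Fin n → ℝ) (g h : Fin L → Fin n → ℝ) (m k : Fin n) :
    ℂ :=
  ∑ l, ∑ b, star (prodFft g h l k) * (star (fft (h l) (b - k)) *
    (phiMatrix L T m (l, b - k) (l, b) * fft (g l) b))

theorem blockEig_apply (n L : ℕ) (a b : Fin L × Fin n) :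
    blockEig n L a b = if a.1 = b.1 then eigMatrix n a.2 b.2 else 0 := by
  simp [blockEig, Matrix.kroneckerMap_apply, Matrix.one_apply]

theorem blockEig_mul_mul_apply {n L : ℕ} (A : Matrix (Fin L × Fin n) (Fin L × Fin n) ℂ)
    (a b : Fin L × Fin n) :
    (blockEig n L * A * (blockEig n L).conjTranspose) a b =
      ∑ x, ∑ y, eigMatrix n a.2 x * A (a.1, x) (b.1, y) * star (eigMatrix n b.2 y) := by
  simp only [Matrix.mul_apply, Matrix.conjTranspose_apply, blockEig_apply, Fintype.sum_prod_type,
    ite_mul, zero_mul, Finset.sum_mul, apply_ite star, star_zero, mul_ite, mul_zero,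
    Finset.sum_ite_irrel, Finset.sum_const_zero, Finset.sum_ite_eq, Finset.mem_univ, if_true]
  rw [Finset.sum_comm]

/-- Orthogonality of characters, for three columns of the eigenvector matrix. -/
theorem sum_eigMatrix_mul (n : ℕ) [NeZero n] (x y k q : Fin n) :
    ∑ p, eigMatrix n p x * star (eigMatrix n p y) * (eigMatrix n p k * star (eigMatrix n q k)) =
      if x = y - k then (n : ℂ)⁻¹ * root n ^ ((q : ℕ) * (k : ℕ)) else 0 := by
  have hs : ((Real.sqrt n : ℝ) : ℂ) * ((Real.sqrt n : ℝ) : ℂ) = n := by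
    rw [← Complex.ofReal_mul, Real.mul_self_sqrt (Nat.cast_nonneg n)]; simp
  have hn : (n : ℂ) ≠ 0 := Nat.cast_ne_zero.2 (NeZero.ne n)
  have hr : root n ≠ 0 := Complex.exp_ne_zero _
  set σ : ℂ := ((Real.sqrt n : ℝ) : ℂ)⁻¹ with hσ
  have hσσ : σ * σ = (n : ℂ)⁻¹ := by rw [hσ, ← mul_inv, hs]
  have hστ : star σ = σ := by rw [hσ, star_inv₀]; congr 1; exact Complex.conj_ofReal _
  have : ∀ p : Fin n,
      eigMatrix n p x * star (eigMatrix n p y) * (eigMatrix n p k * star (eigMatrix n q k)) =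
      (n : ℂ)⁻¹ * (n : ℂ)⁻¹ * root n ^ ((q : ℕ) * (k : ℕ)) *
        root n ^ (((y : ℕ) - (k : ℕ) - (x : ℕ) : ℤ) * (p : ℕ)) := fun p => by
    have e : root n ^ (((y : ℕ) - (k : ℕ) - (x : ℕ) : ℤ) * (p : ℕ)) =
        root n ^ ((p : ℕ) * (y : ℕ)) * (root n)⁻¹ ^ ((p : ℕ) * (k : ℕ)) *
          (root n)⁻¹ ^ ((p : ℕ) * (x : ℕ)) := by
      rw [sub_mul, sub_mul, zpow_sub₀ hr, zpow_sub₀ hr, inv_pow, inv_pow, mul_comm (p : ℕ),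
        mul_comm (p : ℕ), mul_comm (p : ℕ)]
      norm_cast
    rw [e, ← hσσ]
    simp only [eigMatrix_apply, star_mul', star_pow, star_inv₀, star_root, inv_inv, ← hσ, hστ]
    ring
  simp only [this]
  rw [← Finset.mul_sum, sum_root_pow]
  -- Subtraction in `Fin n` is modulo `n`, which turns the divisibility into an equality of indices.
  have hiff : (n : ℤ) ∣ ((y : ℕ) - (k : ℕ) - (x : ℕ) : ℤ) ↔ x = y - k := by
    rw [eq_sub_iff_add_eq, Fin.ext_iff, Fin.val_add, sub_sub, add_comm ((k : ℕ) : ℤ),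
      ← Nat.cast_add, ← Int.modEq_iff_dvd, Int.natCast_modEq_iff, Nat.ModEq,
      Nat.mod_eq_of_lt y.2]
  simp only [hiff]
  split_ifs
  · field_simp
  · ring

/-- This is where the cost drops: only the entries of Φ⁽ᵐ⁾ at `(l, b - k)`, `(l, b)` survive, and
the tensor contribution `freqCum` does not depend on the output index `(l, q)`, so it is computed
once per pair `(m, k)`. -/
theorem newCumC_apply {n L : ℕ} [NeZero n] (T : Fin n → Fin n → Fin n → ℝ)
    (g h : Fin L → Fin n → ℝ) (m : Fin n) (l : Fin L) (q : Fin n) :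
    newCumC T g h m (l, q) = ∑ k, prodFft g h l k * freqCum T g h m k *
      root n ^ ((q : ℕ) * (k : ℕ)) * (((n * (freqEnergy g h k * freqEnergy g h k))⁻¹ : ℝ) : ℂ) := by
  set A : Matrix (Fin L × Fin n) (Fin L × Fin n) ℂ :=
    (Matrix.diagonal (stackedFft h)).conjTranspose * phiMatrix L T m *
      Matrix.diagonal (stackedFft g) with hA
  have hAe : ∀ a b, A a b = star (fft (h a.1) a.2) * (phiMatrix L T m a b * fft (g b.1) b.2) := by
    intro a b
    rw [hA, Matrix.mul_diagonal, Matrix.diagonal_conjTranspose, Matrix.diagonal_mul]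
    simp [stackedFft, mul_assoc]
  have hassoc : blockEig n L * (Matrix.diagonal (stackedFft h)).conjTranspose * phiMatrix L T m *
      Matrix.diagonal (stackedFft g) * (blockEig n L).conjTranspose =
      blockEig n L * A * (blockEig n L).conjTranspose := by
    simp only [hA, Matrix.mul_assoc]
  set X := pinv (psi g h) with hX
  -- Ψ† is diagonal in the frequency, so one of the two frequency sums collapses.
  have hXe : ∀ j p q, (blockEig n L * X * (blockEig n L).conjTranspose) (j, p) (l, q) =
      ∑ k, X (j, k) (l, k) * (eigMatrix n p k * star (eigMatrix n q k)) := by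
    intro j p q
    rw [blockEig_mul_mul_apply]
    refine Finset.sum_congr rfl fun x _ => ?_
    rw [Finset.sum_eq_single x]
    · ring
    · intro y _ hy
      rw [hX, pinv_psi_apply, if_neg (fun h => hy h.symm)]; simp
    · simp
  simp only [newCumC, Matrix.of_apply, hassoc, ← hX]
  rw [Fintype.sum_prod_type]
  simp only [hXe]
  simp only [blockEig_mul_mul_apply]
  -- With the sum over `p` moved innermost, only a product of four eigenvector entries depends on
  -- `p` or `q`; `sum_eigMatrix_mul` evaluates it and eliminates `x`.
  have step : ∀ j : Fin L, ∑ p, (∑ x, ∑ y, eigMatrix n p x * A (j, x) (j, y) *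
      star (eigMatrix n p y)) * ∑ k, X (j, k) (l, k) * (eigMatrix n p k * star (eigMatrix n q k)) =
      ∑ k, ∑ y, A (j, y - k) (j, y) * X (j, k) (l, k) *
        ((n : ℂ)⁻¹ * root n ^ ((q : ℕ) * (k : ℕ))) := by
    intro j
    calc _ = ∑ p, ∑ k, ∑ y, ∑ x, A (j, x) (j, y) * X (j, k) (l, k) *
          (eigMatrix n p x * star (eigMatrix n p y) *
            (eigMatrix n p k * star (eigMatrix n q k))) := by
          refine Finset.sum_congr rfl fun p _ => ?_
          rw [Finset.mul_sum]
          refine Finset.sum_congr rfl fun k _ => ?_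
          rw [Finset.sum_comm, Finset.sum_mul]
          refine Finset.sum_congr rfl fun y _ => ?_
          rw [Finset.sum_mul]
          refine Finset.sum_congr rfl fun x _ => ?_
          ring
      _ = ∑ k, ∑ y, ∑ x, A (j, x) (j, y) * X (j, k) (l, k) *
          ∑ p, (eigMatrix n p x * star (eigMatrix n p y) *
            (eigMatrix n p k * star (eigMatrix n q k))) := by
          simp only [Finset.mul_sum]
          rw [Finset.sum_comm]
          refine Finset.sum_congr rfl fun k _ => ?_
          rw [Finset.sum_comm]
          refine Finset.sum_congr rfl fun y _ => ?_
          rw [Finset.sum_comm]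
      _ = _ := by
          refine Finset.sum_congr rfl fun k _ => Finset.sum_congr rfl fun y _ => ?_
          simp only [sum_eigMatrix_mul, mul_ite, mul_zero, Finset.sum_ite_eq', Finset.mem_univ,
            if_true]
  simp only [step]
  rw [Finset.sum_comm]
  refine Finset.sum_congr rfl fun k _ => ?_
  rw [freqCum, Finset.mul_sum, Finset.sum_mul, Finset.sum_mul]
  refine Finset.sum_congr rfl fun j _ => ?_
  rw [Finset.mul_sum, Finset.sum_mul, Finset.sum_mul]
  refine Finset.sum_congr rfl fun y _ => ?_
  rw [hAe, hX, pinv_psi_apply, if_pos rfl]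
  push_cast
  rw [mul_inv (n : ℂ)]
  ring

end

end ConvTensor

namespace ConvTensor

open Pram

noncomputable section

/-! ### The program of a mode update -/

/-- Processor numbers are mixed-radix numerals whose digits are the indices of a summand; quotient
and remainder recover the digits. -/
theorem mul_add_fin_div {d : ℕ} (y : ℕ) (x : Fin d) : (y * d + x) / d = y := by
  rw [add_comm, Nat.add_mul_div_right _ _ x.pos, Nat.div_eq_of_lt x.2, zero_add]

theorem mul_add_fin_mod {d : ℕ} (y : ℕ) (x : Fin d) : (y * d + x) % d = x := by
  rw [mul_comm, Nat.mul_add_mod, Nat.mod_eq_of_lt x.2]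

theorem mul_add_fin_lt {d y A : ℕ} (hy : y < A) (x : Fin d) : y * d + x < A * d := by
  have := Nat.mul_le_mul_right d (Nat.succ_le_of_lt hy)
  have := x.2
  rw [Nat.succ_mul] at *
  omega

theorem sum_range_mul {M : Type*} [AddCommMonoid M] (L n : ℕ) (F : ℕ → M) :
    ∑ x ∈ Finset.range (L * n), F x = ∑ l : Fin L, ∑ b : Fin n, F (l * n + b) := by
  rw [← Fin.sum_univ_eq_sum_range, ← finProdFinEquiv.sum_comp, Fintype.sum_prod_type]
  refine Finset.sum_congr rfl fun l _ => Finset.sum_congr rfl fun b _ => ?_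
  congr 1
  simp [finProdFinEquiv, add_comm, mul_comm]

/-- Position of the first cell of the block of processors with number `l n + k`. -/
def blockPos (l k : IExpr) : IExpr := (l * .var 0 + k) * .var 0

/-- The summands of the Fourier transforms of the filters in the array `a`. -/
def fftExpr (a : ℕ) : CExpr :=
  .rmul (.cell 4 ((.self / .var 0 % .var 0) * (.self % .var 0) % .var 0))
    (.cell a (.self / .var 0 / .var 0 * .var 0 + .self % .var 0))

/-- Fourier coefficient `k` of the convolution of the `l`-th filters. -/
def prodExpr (l k : IExpr) : CExpr := .mul (.cell 12 (blockPos l k)) (.cell 14 (blockPos l k))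

/-- The summands of `freqEnergy`. -/
def energyExpr : RExpr :=
  .add (.mul (prodExpr (.self % .var 1) (.self / .var 1)).re
      (prodExpr (.self % .var 1) (.self / .var 1)).re)
    (.mul (prodExpr (.self % .var 1) (.self / .var 1)).im
      (prodExpr (.self % .var 1) (.self / .var 1)).im)

/-- The summand of `freqCum` with indices `m`, `k`, `l`, `b`, where `b'` is `b - k`. -/
def freqCumTerm (m k l b b' : IExpr) : CExpr :=
  .mul (.conj (prodExpr l k)) (.mul (.conj (.cell 14 (blockPos l b'))) (.mul
    (.cell 2 ((m * (.var 1 * .var 0) + (l * .var 0 + b')) * (.var 1 * .var 0) + (l * .var 0 + b)))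
    (.cell 12 (blockPos l b))))

/-- The summands of `freqCum`. -/
def freqCumExpr : CExpr :=
  freqCumTerm (.self / .var 0 / .var 1 / .var 0) (.self / .var 0 / .var 1 % .var 0)
    (.self / .var 0 % .var 1) (.self % .var 0)
    ((.var 0 - (.self / .var 0 / .var 1 % .var 0) + .self % .var 0) % .var 0)

/-- The summand of `M` with indices `m`, `l`, `q`, `k`. -/
def newCumTerm (m l q k : IExpr) : RExpr :=
  .div (CExpr.mul (.mul (prodExpr l k) (.cell 17 ((m * .var 0 + k) * (.var 1 * .var 0))))
      (.cell 4 (q * k % .var 0))).re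
    (.mul (.ofInt (.var 0)) (.mul (.cell 16 (k * .var 1)) (.cell 16 (k * .var 1))))

/-- The summands of `M`. -/
def newCumExpr : RExpr :=
  newCumTerm (.self / .var 0 / .var 0 / .var 1) (.self / .var 0 / .var 0 % .var 1)
    (.self / .var 0 % .var 0) (.self % .var 0)

/-- Position of the entry `(m, (l, q))` of `M`. -/
def entryPos (m l q : IExpr) : IExpr := ((m * .var 1 + l) * .var 0 + q) * .var 0

/-- The summands of the squared norms of the columns of `M`. -/
def sqExpr : RExpr :=
  .mul (.cell 19 (entryPos (.self % .var 0) (.self / .var 0 / .var 0) (.self / .var 0 % .var 0)))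
    (.cell 19 (entryPos (.self % .var 0) (.self / .var 0 / .var 0) (.self / .var 0 % .var 0)))

/-- The nonzero summands of the filter update. -/
def filterExpr : RExpr :=
  .div (.cell 19 (entryPos ((.self / .var 0 % .var 0 + .self % .var 0) % .var 0)
      (.self / .var 0 / .var 0) (.self % .var 0)))
    (.cell 21 (.self / .var 0 / .var 0 * .var 0 + .self % .var 0))

/-- The update of a mode: from the filters in the arrays `ag` and `ah`, compute the filters in `af`
and the weights in `aw`. -/
def modeProg (ag ah af aw : ℕ) : Prog :=
  (csumProg 12 (fftExpr ag) (.var 0)).seq <|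
  (csumProg 14 (fftExpr ah) (.var 0)).seq <|
  (sumProg 16 energyExpr (.var 1)).seq <|
  (csumProg 17 freqCumExpr (.var 1 * .var 0)).seq <|
  (sumProg 19 newCumExpr (.var 0)).seq <|
  (sumProg 20 sqExpr (.var 0)).seq <|
  (Prog.par (.const 1) 21 (.sqrt ⟨20, .self * .var 0⟩)).seq <|
  (sumProg 22 filterExpr (.var 0)).seq <|
  (Prog.par (.const 1) 23 (.ofInt (.var 0))).seq <|
  (Prog.par (.const 1) aw (.copy ⟨21, .self⟩)).seq
    (.par (.const 1) af (.div ⟨22, .self * .var 0⟩ ⟨23, .self⟩))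

/-- The cost of a mode update, per unit of `Nat.clog 2 (n * L)`. -/
def modeCost (ag ah : ℕ) : ℕ :=
  csumCost (fftExpr ag) + (csumCost (fftExpr ah) + (sumCost energyExpr + (csumCost freqCumExpr +
    (sumCost newCumExpr + (sumCost sqExpr + (1 + (sumCost filterExpr + (1 + (1 + 1)))))))))

/-! ### Values of the expressions -/

/-- The state holds the sizes, the matrices `Φ⁽ᵐ⁾` and the roots of unity. -/
structure HoldsConstants {n : ℕ} (L : ℕ) (T : Fin n → Fin n → Fin n → ℝ) (s : State) :
    Prop where
  size_n : s.vars 0 = n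
  size_L : s.vars 1 = L
  phi : ∀ (m : Fin n) (a b : Fin L × Fin n), s.cmem 2 (phiAddress m a b) = phiMatrix L T m a b
  root : ∀ k : Fin n, s.cmem 4 k = root n ^ (k : ℕ)

/-- The state holds a complex number for each block and position. -/
def HoldsComplex {n L : ℕ} (s : State) (a : ℕ) (x : Fin L → Fin n → ℂ) : Prop :=
  ∀ (l : Fin L) (k : Fin n), s.cmem a ((l * n + k) * n) = x l k

variable {n L : ℕ} {T : Fin n → Fin n → Fin n → ℝ} {f g h : Fin L → Fin n → ℝ} {s s' : State}
  {b : ℕ}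

/-- The bound 6 is there because the constants occupy the arrays 2 to 5. -/
theorem HoldsConstants.frame (hs : HoldsConstants L T s) (hf : Frame b s s') (hb : 6 ≤ b) :
    HoldsConstants L T s' where
  size_n := (hf.vars 0 (by omega)).trans hs.size_n
  size_L := (hf.vars 1 (by omega)).trans hs.size_L
  phi m a c := (hf.cmem (by omega) _).trans (hs.phi m a c)
  root k := (hf.cmem (by omega) _).trans (hs.root k)

theorem HoldsComplex.frame {a : ℕ} {x : Fin L → Fin n → ℂ} (hs : HoldsComplex s a x)
    (hf : Frame b s s') (hb : a + 1 < b) : HoldsComplex s' a x :=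
  fun l k => (hf.cmem hb _).trans (hs l k)

theorem HoldsFilters.frame {a : ℕ} (hs : HoldsFilters s a f) (hf : Frame b s s') (ha : a < b) :
    HoldsFilters s' a f :=
  fun l p => (congrFun (hf.mem a ha) _).trans (hs l p)

theorem HoldsConstants.root_mod [NeZero n] (hs : HoldsConstants L T s) (k : ℕ) :
    s.cmem 4 (k % n) = ConvTensor.root n ^ k := by
  rw [← root_pow_mod n k]
  exact hs.root ⟨k % n, Nat.mod_lt _ (NeZero.pos n)⟩

theorem eval_fftExpr [NeZero n] (hs : HoldsConstants L T s) {a : ℕ} (hf : HoldsFilters s a f)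
    (l : Fin L) (k p : Fin n) :
    (fftExpr a).eval ((l * n + k) * n + p) s = dftMatrix n k p * (f l p : ℂ) := by
  rw [fftExpr, CExpr.eval_rmul, CExpr.eval_cell, RExpr.eval]
  simp only [IExpr.eval_add, IExpr.eval_mul, IExpr.eval_div, IExpr.eval_mod, IExpr.eval_var,
    IExpr.eval_self, hs.size_n, mul_add_fin_div, mul_add_fin_mod, hs.root_mod, hf l p]
  rfl

theorem eval_prodExpr (hs : HoldsConstants L T s) (hV : HoldsComplex s 12 fun l => fft (g l))
    (hZ : HoldsComplex s 14 fun l => fft (h l)) {i : ℕ} {el ek : IExpr} {l : Fin L} {k : Fin n}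
    (hl : el.eval i s.vars = l) (hk : ek.eval i s.vars = k) :
    (prodExpr el ek).eval i s = prodFft g h l k := by
  rw [prodExpr, CExpr.eval_mul, CExpr.eval_cell, CExpr.eval_cell, prodFft]
  simp only [blockPos, IExpr.eval_add, IExpr.eval_mul, IExpr.eval_var, hs.size_n, hl, hk, hV l k,
    hZ l k]

theorem eval_energyExpr (hs : HoldsConstants L T s) (hV : HoldsComplex s 12 fun l => fft (g l))
    (hZ : HoldsComplex s 14 fun l => fft (h l)) (k : Fin n) (l : Fin L) :
    energyExpr.eval (k * L + l) s = Complex.normSq (prodFft g h l k) := by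
  rw [← eval_prodExpr hs hV hZ (i := k * L + l) (el := .self % .var 1) (ek := .self / .var 1)
    (by simp [hs.size_L, Nat.mod_eq_of_lt l.2]) (by simp [hs.size_L, mul_add_fin_div]),
    Complex.normSq_apply]
  rfl

theorem eval_freqCumTerm (hs : HoldsConstants L T s) (hV : HoldsComplex s 12 fun l => fft (g l))
    (hZ : HoldsComplex s 14 fun l => fft (h l)) {i : ℕ} {em ek el eb eb' : IExpr}
    {m k b b' : Fin n} {l : Fin L} (hm : em.eval i s.vars = m) (hk : ek.eval i s.vars = k)
    (hl : el.eval i s.vars = l) (hb : eb.eval i s.vars = b) (hb' : eb'.eval i s.vars = b') :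
    (freqCumTerm em ek el eb eb').eval i s = star (prodFft g h l k) * (star (fft (h l) b') *
      (phiMatrix L T m (l, b') (l, b) * fft (g l) b)) := by
  rw [freqCumTerm, CExpr.eval_mul, CExpr.eval_mul, CExpr.eval_mul, CExpr.eval_conj,
    CExpr.eval_conj, eval_prodExpr hs hV hZ hl hk, CExpr.eval_cell, CExpr.eval_cell,
    CExpr.eval_cell, ← hs.phi]
  simp only [blockPos, IExpr.eval_add, IExpr.eval_mul, IExpr.eval_var, hs.size_n, hs.size_L, hl,
    hm, hb, hb', hV l b, hZ l b']
  rfl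

theorem eval_freqCumExpr (hs : HoldsConstants L T s) (hV : HoldsComplex s 12 fun l => fft (g l))
    (hZ : HoldsComplex s 14 fun l => fft (h l)) (m k b : Fin n) (l : Fin L) :
    freqCumExpr.eval ((m * n + k) * (L * n) + (l * n + b)) s =
      star (prodFft g h l k) * (star (fft (h l) (b - k)) *
        (phiMatrix L T m (l, b - k) (l, b) * fft (g l) b)) := by
  have e : ((m : ℕ) * n + k) * (L * n) + (l * n + b) = ((m * n + k) * L + l) * n + b := by ring
  rw [e]
  -- The digits are m, k, l, b. The index b - k is coded as (n - k + b) mod n, the definition of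
  -- subtraction in `Fin n`, so that truncation does no harm.
  apply eval_freqCumTerm hs hV hZ <;>
    simp [hs.size_n, hs.size_L, mul_add_fin_div, Nat.mod_eq_of_lt, Fin.val_sub]

/-- The denominator is real, so one real division of the real part suffices. At zero energy the
machine's x / 0 = 0 agrees with the inverse in the closed form. -/
theorem eval_newCumTerm [NeZero n] (hs : HoldsConstants L T s)
    (hV : HoldsComplex s 12 fun l => fft (g l)) (hZ : HoldsComplex s 14 fun l => fft (h l))
    (hS : ∀ k : Fin n, s.mem 16 (k * L) = freqEnergy g h k)
    (hE : ∀ m k : Fin n, s.cmem 17 ((m * n + k) * (L * n)) = freqCum T g h m k)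
    {i : ℕ} {em el eq ek : IExpr} {m q k : Fin n} {l : Fin L} (hm : em.eval i s.vars = m)
    (hl : el.eval i s.vars = l) (hq : eq.eval i s.vars = q) (hk : ek.eval i s.vars = k) :
    (newCumTerm em el eq ek).eval i s = (prodFft g h l k * freqCum T g h m k *
      root n ^ ((q : ℕ) * (k : ℕ)) *
        (((n * (freqEnergy g h k * freqEnergy g h k))⁻¹ : ℝ) : ℂ)).re := by
  rw [Complex.re_mul_ofReal, ← div_eq_mul_inv, newCumTerm]
  simp only [RExpr.eval]
  congr 1
  · have hre : ∀ x : CExpr, x.re.eval i s = (x.eval i s).re := fun _ => rfl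
    rw [hre, CExpr.eval_mul, CExpr.eval_mul, eval_prodExpr hs hV hZ hl hk, CExpr.eval_cell,
      CExpr.eval_cell]
    simp only [IExpr.eval_add, IExpr.eval_mul, IExpr.eval_mod, IExpr.eval_var, hs.size_n,
      hs.size_L, hm, hk, hq, hE, hs.root_mod]
  · simp only [IExpr.eval_mul, IExpr.eval_var, hs.size_n, hs.size_L, hk, hS]

theorem eval_newCumExpr [NeZero n] (hs : HoldsConstants L T s)
    (hV : HoldsComplex s 12 fun l => fft (g l)) (hZ : HoldsComplex s 14 fun l => fft (h l))
    (hS : ∀ k : Fin n, s.mem 16 (k * L) = freqEnergy g h k)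
    (hE : ∀ m k : Fin n, s.cmem 17 ((m * n + k) * (L * n)) = freqCum T g h m k)
    (m q k : Fin n) (l : Fin L) :
    newCumExpr.eval (((m * L + l) * n + q) * n + k) s = (prodFft g h l k * freqCum T g h m k *
      root n ^ ((q : ℕ) * (k : ℕ)) *
        (((n * (freqEnergy g h k * freqEnergy g h k))⁻¹ : ℝ) : ℂ)).re := by
  apply eval_newCumTerm hs hV hZ hS hE <;>
    simp [hs.size_n, hs.size_L, mul_add_fin_div, Nat.mod_eq_of_lt]

/-- The array `19` holds `M`. -/
def HoldsEntries (s : State) (M : Matrix (Fin n) (Fin L × Fin n) ℝ) : Prop :=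
  ∀ (m : Fin n) (l : Fin L) (q : Fin n), s.mem 19 (((m * L + l) * n + q) * n) = M m (l, q)

theorem eval_sqExpr (hs : HoldsConstants L T s) {M : Matrix (Fin n) (Fin L × Fin n) ℝ}
    (hM : HoldsEntries s M) (l : Fin L) (q m : Fin n) :
    sqExpr.eval ((l * n + q) * n + m) s = M m (l, q) ^ 2 := by
  simp only [sqExpr, entryPos, RExpr.eval, IExpr.eval_add, IExpr.eval_mul, IExpr.eval_div,
    IExpr.eval_mod, IExpr.eval_var, IExpr.eval_self, hs.size_n, hs.size_L, mul_add_fin_div,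
    mul_add_fin_mod, hM m l q, sq]

theorem eval_filterExpr (hs : HoldsConstants L T s) {M : Matrix (Fin n) (Fin L × Fin n) ℝ}
    (hM : HoldsEntries s M) (hN : HoldsFilters s 21 fun l q => colNorm M (l, q)) (l : Fin L)
    (p j : Fin n) :
    filterExpr.eval ((l * n + p) * n + j) s = M (p + j) (l, j) / colNorm M (l, j) := by
  simp only [filterExpr, entryPos, RExpr.eval, IExpr.eval_add, IExpr.eval_mul, IExpr.eval_div,
    IExpr.eval_mod, IExpr.eval_var, IExpr.eval_self, hs.size_n, hs.size_L, mul_add_fin_div,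
    mul_add_fin_mod, hN l j, ← Fin.val_add, hM (p + j) l j]

/-- For given `p` and `j` the only `i` with i - j = p is p + j. Each filter entry is thus a sum of
`n` terms, and the normalizing count is `n`. -/
theorem filterUpdate_eq (M : Matrix (Fin n) (Fin L × Fin n) ℝ) (l : Fin L) (p : Fin n) :
    filterUpdate M l p = (∑ j, M (p + j) (l, j) / colNorm M (l, j)) / n := by
  have : NeZero n := ⟨p.pos.ne'⟩
  rw [filterUpdate, Finset.sum_comm]
  congr 1
  · refine Finset.sum_congr rfl fun j _ => ?_
    simp only [sub_eq_iff_eq_add, mul_ite, mul_one, mul_zero, Finset.sum_ite_eq',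
      Finset.mem_univ, if_true]
    rw [div_eq_mul_inv, mul_comm]
  · rw [Finset.sum_comm]
    simp [sub_eq_iff_eq_add]

/-! ### Correctness and cost of a mode update -/

theorem Runs.par {P ℓ : ℕ} (hℓ : 0 < ℓ) (guard : IExpr) (arr : ℕ) (op : Op) (s : State) :
    Runs P ℓ 1 (.par guard arr op) s (s.parStep P guard arr op) :=
  ⟨1, by omega, .par _ _ _ _⟩

theorem below_fftExpr {a b : ℕ} (ha : a < b) (hb : 6 ≤ b) : (fftExpr a).Below b := by
  simp [fftExpr, CExpr.Below, CExpr.rmul, CExpr.cell, RExpr.Below]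
  omega

/-- The two largest families, the terms of `freqCum` (n² sums of length L n) and those of M (L n²
sums of length n), have exactly L n³ members; this is the hypothesis `hP`. Scratch arrays start at
12, so the inputs and earlier results survive. -/
theorem exec_modeProg {ag ah af aw : ℕ} (hag : ag < 12) (hah : ah < 12)
    (haw : aw < 12) (hne : af ≠ aw) {P : ℕ} (hn : 1 ≤ n) (hL : 1 ≤ L) (hnL : 2 ≤ n * L)
    (hP : L * n * n * n ≤ P) (hs : HoldsConstants L T s) (hg : HoldsFilters s ag g)
    (hh : HoldsFilters s ah h) :
    ∃ s', Runs P (Nat.clog 2 (n * L)) (modeCost ag ah) (modeProg ag ah af aw) s s' ∧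
      (∀ x < 3, s'.vars x = s.vars x) ∧
      (∀ a < 12, a ≠ af → a ≠ aw → s'.mem a = s.mem a) ∧
      HoldsFilters s' af (modeFilters T g h) ∧ HoldsFilters s' aw (modeWeights T g h) := by
  have : NeZero n := ⟨by omega⟩
  set ℓ := Nat.clog 2 (n * L)
  have hℓ0 : 0 < ℓ := Nat.clog_pos one_lt_two hnL
  have hn0 : 0 < n := hn
  have hL0 : 0 < L := hL
  have hℓn : Nat.clog 2 n ≤ ℓ := Nat.clog_mono_right 2 (Nat.le_mul_of_pos_right n hL0)
  have hℓL : Nat.clog 2 L ≤ ℓ := Nat.clog_mono_right 2 (Nat.le_mul_of_pos_left L hn0)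
  have hℓLn : Nat.clog 2 (L * n) ≤ ℓ := by rw [mul_comm]
  have hLnn : L * n * n ≤ P := (Nat.le_mul_of_pos_right _ hn0).trans hP
  have hLn : L * n ≤ P := (Nat.le_mul_of_pos_right _ hn0).trans hLnn
  have hpos : ∀ (l : Fin L) (k : Fin n), (l : ℕ) * n + k < L * n := fun l k =>
    mul_add_fin_lt l.2 k
  have hblock : ∀ (l : Fin L) (k : Fin n), ((l : ℕ) * n + k + 1) * n ≤ P := fun l k =>
    (Nat.mul_le_mul_right n (hpos l k)).trans hLnn
  have fft_spec : ∀ {a b : ℕ} {f : Fin L → Fin n → ℝ} {s s' : State}, HoldsConstants L T s →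
      HoldsFilters s a f → (∀ K, (K + 1) * n ≤ P → s'.cmem b (K * n) =
        ∑ x ∈ Finset.range n, (fftExpr a).eval (K * n + x) s) →
      HoldsComplex s' b fun l => fft (f l) := by
    intro a b f s s' hs hf hv l k
    rw [hv _ (hblock l k), Finset.sum_range]
    exact Finset.sum_congr rfl fun p _ => eval_fftExpr hs hf l k p
  -- Fourier transforms
  obtain ⟨s₁, r₁, f₁, v₁⟩ := exec_csumProg P ℓ 12 (.var 0) (below_fftExpr hag (by omega))
    (by simp) hs.size_n hn0 hℓ0 hℓn
  have V₁ : HoldsComplex s₁ 12 fun l => fft (g l) := fft_spec hs hg v₁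
  have c₁ := hs.frame f₁ (by omega)
  obtain ⟨s₂, r₂, f₂, v₂⟩ := exec_csumProg P ℓ 14 (.var 0)
    (below_fftExpr (a := ah) (by omega) (by omega)) (by simp) c₁.size_n hn0 hℓ0 hℓn
  have Z₂ : HoldsComplex s₂ 14 fun l => fft (h l) := fft_spec c₁ (hh.frame f₁ hah) v₂
  have V₂ := V₁.frame f₂ (by omega)
  have c₂ := c₁.frame f₂ (by omega)
  -- energies
  obtain ⟨s₃, r₃, f₃, v₃⟩ := exec_sumProg P ℓ 16 (e := energyExpr) (.var 1)
    (by simp [energyExpr, prodExpr, blockPos, CExpr.mul, CExpr.cell, RExpr.Below])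
    (by simp) c₂.size_L hL0 hℓ0 hℓL
  have S₃ : ∀ k : Fin n, s₃.mem 16 (k * L) = freqEnergy g h k := fun k => by
    rw [v₃ _ ((Nat.mul_le_mul_right L k.2).trans (by rwa [mul_comm])), Finset.sum_range]
    exact Finset.sum_congr rfl fun l _ => eval_energyExpr c₂ V₂ Z₂ k l
  have V₃ := V₂.frame f₃ (by omega)
  have Z₃ := Z₂.frame f₃ (by omega)
  have c₃ := c₂.frame f₃ (by omega)
  -- contributions of the tensor
  obtain ⟨s₄, r₄, f₄, v₄⟩ := exec_csumProg P ℓ 17 (e := freqCumExpr) (s := s₃)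
    (.var 1 * .var 0)
    (by simp [freqCumExpr, freqCumTerm, prodExpr, blockPos, CExpr.Below, CExpr.mul, CExpr.conj,
      CExpr.cell, RExpr.Below])
    (by simp) (N := L * n) (by simp [c₃.size_n, c₃.size_L]) (by positivity) hℓ0 hℓLn
  have E₄ : ∀ m k : Fin n, s₄.cmem 17 ((m * n + k) * (L * n)) = freqCum T g h m k := by
    intro m k
    have hmk := Nat.mul_le_mul_right (L * n) (Nat.succ_le_of_lt (mul_add_fin_lt m.2 k))
    rw [v₄ _ (hmk.trans (le_trans (le_of_eq (by ring)) hP)), sum_range_mul]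
    exact Finset.sum_congr rfl fun l _ => Finset.sum_congr rfl fun b _ =>
      eval_freqCumExpr c₃ V₃ Z₃ m k b l
  have V₄ := V₃.frame f₄ (by omega)
  have Z₄ := Z₃.frame f₄ (by omega)
  have c₄ := c₃.frame f₄ (by omega)
  have S₄ : ∀ k : Fin n, s₄.mem 16 (k * L) = freqEnergy g h k := fun k => by
    rw [f₄.mem 16 (by omega), S₃]
  -- the matrix `M`
  obtain ⟨s₅, r₅, f₅, v₅⟩ := exec_sumProg P ℓ 19 (e := newCumExpr) (.var 0)
    (by simp [newCumExpr, newCumTerm, prodExpr, blockPos, CExpr.mul, CExpr.cell, RExpr.Below])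
    (by simp) c₄.size_n hn0 hℓ0 hℓn
  have M₅ : HoldsEntries s₅ (newCum T g h) := by
    intro m l q
    have hml := Nat.mul_le_mul_right n (Nat.succ_le_of_lt
      (mul_add_fin_lt (mul_add_fin_lt m.2 l) q))
    rw [v₅ _ (hml.trans (le_trans (le_of_eq (by ring)) hP)), Finset.sum_range, newCum,
      Matrix.map_apply, newCumC_apply, Complex.re_sum]
    exact Finset.sum_congr rfl fun k _ => eval_newCumExpr c₄ V₄ Z₄ S₄ E₄ m q k l
  have c₅ := c₄.frame f₅ (by omega)
  -- norms of its columns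
  obtain ⟨s₆, r₆, f₆, v₆⟩ := exec_sumProg P ℓ 20 (e := sqExpr) (.var 0)
    (by simp [sqExpr, entryPos, RExpr.Below]) (by simp) c₅.size_n hn0 hℓ0 hℓn
  have c₆ := c₅.frame f₆ (by omega)
  set s₇ := s₆.parStep P (.const 1) 21 (.sqrt ⟨20, .self * .var 0⟩) with hs₇
  have f₇ : Frame 21 s₆ s₇ := State.frame_parStep _ _ _ _ _
  have c₇ := c₆.frame f₇ (by omega)
  have N₇ : HoldsFilters s₇ 21 (modeWeights T g h) := by
    intro l q
    rw [hs₇, State.parStep_mem_self _ _ ((hpos l q).trans_le hLn)]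
    simp only [Op.eval, Operand.eval, IExpr.eval_mul, IExpr.eval_self, IExpr.eval_var, c₆.size_n]
    rw [v₆ _ (hblock l q), Finset.sum_range, modeWeights, colNorm]
    exact congrArg Real.sqrt (Finset.sum_congr rfl fun m _ => eval_sqExpr c₅ M₅ l q m)
  have M₇ : HoldsEntries s₇ (newCum T g h) := fun m l q => by
    rw [f₇.mem 19 (by omega), f₆.mem 19 (by omega)]
    exact M₅ m l q
  -- filters
  obtain ⟨s₈, r₈, f₈, v₈⟩ := exec_sumProg P ℓ 22 (e := filterExpr) (.var 0)
    (by simp [filterExpr, entryPos, RExpr.Below]) (by simp) c₇.size_n hn0 hℓ0 hℓn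
  have c₈ := c₇.frame f₈ (by omega)
  set s₉ := s₈.parStep P (.const 1) 23 (.ofInt (.var 0)) with hs₉
  have f₉ : Frame 23 s₈ s₉ := State.frame_parStep _ _ _ _ _
  have c₉ := c₈.frame f₉ (by omega)
  set s₁₀ := s₉.parStep P (.const 1) aw (.copy ⟨21, .self⟩) with hs₁₀
  set s₁₁ := s₁₀.parStep P (.const 1) af (.div ⟨22, .self * .var 0⟩ ⟨23, .self⟩) with hs₁₁
  -- Only the last two instructions write below the array 12, and they write to `aw` and `af`.
  have F : Frame 12 s s₉ := (((((((f₁.trans f₂ (by omega)).trans f₃ (by omega)).trans f₄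
    (by omega)).trans f₅ (by omega)).trans f₆ (by omega)).trans f₇ (by omega)).trans f₈
    (by omega)).trans f₉ (by omega)
  refine ⟨s₁₁, r₁.seq (r₂.seq (r₃.seq (r₄.seq (r₅.seq (r₆.seq ((Runs.par hℓ0 _ _ _ _).seq
    (r₈.seq ((Runs.par hℓ0 _ _ _ _).seq ((Runs.par hℓ0 _ _ _ _).seq
    (Runs.par hℓ0 _ _ _ _)))))))))), F.vars, fun a ha haf' haw' => ?_, fun l p => ?_,
    fun l p => ?_⟩
  · rw [hs₁₁, State.parStep_mem_ne _ _ _ haf', hs₁₀, State.parStep_mem_ne _ _ _ haw', F.mem a ha]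
  · have hlp := (hpos l p).trans_le hLn
    have hvars : s₁₀.vars 0 = n := c₉.size_n
    rw [hs₁₁, State.parStep_mem_self _ _ hlp]
    simp only [Op.eval, Operand.eval, IExpr.eval_mul, IExpr.eval_self, IExpr.eval_var, hvars]
    rw [hs₁₀, State.parStep_mem_ne (a := 22) _ _ _ (by omega),
      State.parStep_mem_ne (a := 23) _ _ _ (by omega), hs₉, State.parStep_mem_self _ _ hlp,
      State.parStep_mem_ne _ _ _ (by omega), v₈ _ (hblock l p),
      Finset.sum_range, modeFilters, filterUpdate_eq]
    congr 1
    · exact Finset.sum_congr rfl fun j _ => eval_filterExpr c₇ M₇ N₇ l p j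
    · simp [Op.eval, c₈.size_n]
  · rw [hs₁₁, State.parStep_mem_ne _ _ _ hne.symm, hs₁₀,
      State.parStep_mem_self _ _ ((hpos l p).trans_le hLn)]
    simp only [Op.eval, Operand.eval, IExpr.eval_self]
    rw [f₉.mem 21 (by omega), f₈.mem 21 (by omega), N₇]

end

end ConvTensor

/-! ### The full iteration and the bound by natural logarithms. -/

namespace ConvTensor

open Pram

theorem IsInput.holdsConstants {n L P : ℕ} {T : Fin n → Fin n → Fin n → ℝ}
    {g h : Fin L → Fin n → ℝ} {s : State} (hs : IsInput P T g h s) : HoldsConstants L T s where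
  size_n := hs.size_n
  size_L := hs.size_L
  phi m a b := Complex.ext (hs.phi_re m a b) (hs.phi_im m a b)
  root k := Complex.ext (hs.root_re k) (hs.root_im k)

/-- The rounded logarithm is at most 1 + log₂ N ≤ 2 log₂ N for N ≥ 2, and 2 / log 2 < 3. -/
theorem clog_le_three_mul_log {N : ℕ} (hN : 2 ≤ N) : (Nat.clog 2 N : ℝ) ≤ 3 * Real.log N := by
  have hlt : 2 ^ (Nat.clog 2 N).pred < N := Nat.pow_pred_clog_lt_self one_lt_two hN
  have hpos : 0 < Nat.clog 2 N := Nat.clog_pos one_lt_two hN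
  obtain ⟨k, hk⟩ : ∃ k, Nat.clog 2 N = k + 1 := ⟨_, (Nat.succ_pred_eq_of_pos hpos).symm⟩
  rw [hk, Nat.pred_succ] at hlt
  have h1 : (k : ℝ) * Real.log 2 ≤ Real.log N := by
    rw [← Real.log_pow]
    exact Real.log_le_log (by positivity) (by exact_mod_cast hlt.le)
  have h2 : Real.log 2 ≤ Real.log N := Real.log_le_log two_pos (by exact_mod_cast hN)
  have h3 := Real.log_two_gt_d9
  rw [hk]
  push_cast
  have : 0.69 * ((k : ℝ) + 1) ≤ (k + 1) * Real.log 2 := by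
    rw [mul_comm]
    exact mul_le_mul_of_nonneg_left (by linarith) (by positivity)
  linarith

end ConvTensor

theorem mainTheorem4 :
    ∃ (prog : Pram.Prog) (c : ℕ), ∀ (n L : ℕ), 1 ≤ n → 1 ≤ L → 2 ≤ n * L →
      ∀ (T : Fin n → Fin n → Fin n → ℝ) (g h : Fin L → Fin n → ℝ) (s : Pram.State),
        ConvTensor.IsInput (c * (L ^ 2 * n ^ 3)) T g h s →
        ∃ (s' : Pram.State) (t : ℕ),
          Pram.Exec (c * (L ^ 2 * n ^ 3)) prog s s' t ∧
          (t : ℝ) ≤ c * (Real.log n + Real.log L) ∧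
          ConvTensor.IsOutput (ConvTensor.sweep T g h) s' := by
  set C := ConvTensor.modeCost 0 1 + (ConvTensor.modeCost 1 6 + ConvTensor.modeCost 6 7)
  -- Each update reads the newest filters: (g, h), then (h, f'), then (f', g'). In `3 * C + 1` the 3
  -- comes from `clog_le_three_mul_log`, and the 1 guarantees at least L² n³ processors.
  refine ⟨(ConvTensor.modeProg 0 1 6 9).seq ((ConvTensor.modeProg 1 6 7 10).seq
    (ConvTensor.modeProg 6 7 8 11)), 3 * C + 1,
    fun n L hn hL hnL T g h s hs => ?_⟩
  set P := (3 * C + 1) * (L ^ 2 * n ^ 3)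
  have hP : L * n * n * n ≤ P := by
    calc L * n * n * n = 1 * (L ^ 1 * n ^ 3) := by ring
      _ ≤ P := Nat.mul_le_mul (by omega)
        (Nat.mul_le_mul_right _ (Nat.pow_le_pow_right hL (by omega)))
  have frame : ∀ {s s' : Pram.State} {af aw : ℕ}, 6 ≤ af → 6 ≤ aw →
      (∀ x < 3, s'.vars x = s.vars x) →
      (∀ a < 12, a ≠ af → a ≠ aw → s'.mem a = s.mem a) → Pram.Frame 6 s s' :=
    fun haf haw hv hm => ⟨hv, fun a ha => hm a (by omega) (by omega) (by omega)⟩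
  have keep : ∀ {s s' : Pram.State} {a : ℕ} {x : Fin L → Fin n → ℝ}, s'.mem a = s.mem a →
      ConvTensor.HoldsFilters s a x → ConvTensor.HoldsFilters s' a x :=
    fun e hx l p => (congrFun e _).trans (hx l p)
  have c := hs.holdsConstants
  obtain ⟨s₁, r₁, v₁, m₁, f₁, w₁⟩ := ConvTensor.exec_modeProg (af := 6) (aw := 9)
    (by omega) (by omega) (by omega) (by omega) hn hL hnL hP c hs.filters_g hs.filters_h
  have c₁ := c.frame (frame (by omega) (by omega) v₁ m₁) le_rfl
  obtain ⟨s₂, r₂, v₂, m₂, f₂, w₂⟩ := ConvTensor.exec_modeProg (af := 7) (aw := 10)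
    (by omega) (by omega) (by omega) (by omega) hn hL hnL hP c₁
    (keep (m₁ 1 (by omega) (by omega) (by omega)) hs.filters_h) f₁
  have c₂ := c₁.frame (frame (by omega) (by omega) v₂ m₂) le_rfl
  have f₁' := keep (m₂ 6 (by omega) (by omega) (by omega)) f₁
  have w₁' := keep (m₂ 9 (by omega) (by omega) (by omega)) w₁
  obtain ⟨s₃, r₃, v₃, m₃, f₃, w₃⟩ := ConvTensor.exec_modeProg (af := 8) (aw := 11)
    (by omega) (by omega) (by omega) (by omega) hn hL hnL hP c₂ f₁' f₂
  obtain ⟨t, ht, e⟩ := r₁.seq (r₂.seq r₃)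
  refine ⟨s₃, t, e, ?_, ?_⟩
  · have hlog : Real.log n + Real.log L = Real.log ((n * L : ℕ) : ℝ) := by
      rw [Nat.cast_mul, Real.log_mul (by positivity) (by positivity)]
    have h1 := ConvTensor.clog_le_three_mul_log hnL
    have h2 : (t : ℝ) ≤ (C : ℝ) * (Nat.clog 2 (n * L) : ℝ) := by
      exact_mod_cast ht
    have h3 : 0 ≤ Real.log ((n * L : ℕ) : ℝ) := Real.log_natCast_nonneg _
    have h4 := mul_le_mul_of_nonneg_left h1 (Nat.cast_nonneg (α := ℝ) C)
    rw [hlog]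
    push_cast at *
    linarith
  · exact ⟨keep (m₃ 6 (by omega) (by omega) (by omega)) f₁',
      keep (m₃ 7 (by omega) (by omega) (by omega)) f₂, f₃,
      keep (m₃ 9 (by omega) (by omega) (by omega)) w₁',
      keep (m₃ 10 (by omega) (by omega) (by omega)) w₂, w₃⟩
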